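/- Let $2<p<\infty$ and let $X=\ell_p$ be the complex Banach space of $p$-summable sequences $(x_j)_{j\ge 0}$ of complex numbers. Let $\mathcal B_1(X)$ be the set of all bounded linear operators $T:X\to X$ with $\|T\|\le 1$, endowed with the strong operator topology $\mathrm{SOT}$ (the topology of pointwise norm convergence). We say that a typical $T\in(\mathcal B_1(X),\mathrm{SOT})$ has a given property if the set of all $T\in\mathcal B_1(X)$ with this property contains a dense $G_\delta$ subset of $(\mathcal B_1(X),\mathrm{SOT})$. An operator $S$ on a Banach space $Y$ is called hypercyclic if there is $y\in Y$ whose orbit $\{S^n y : n\ge 0\}$ is norm-dense in $Y$. Then, for every real number $M>1$, a typical $T\in(\mathcal B_1(X),\mathrm{SOT})$ is such that the adjoint $(MT)^*$, acting on the dual space $X^*$, is hypercyclic. In particular, a typical $T\in(\mathcal B_1(X),\mathrm{SOT})$ has no eigenvalue. -/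

import Mathlib

open scoped ENNReal

noncomputable section

/-- A typical `z : Z` satisfies `P`: the set of all `z` satisfying `P` is comeager, in the sense that
it contains a dense `G_δ` subset of `Z`. -/
def IsTypical {Z : Type*} [TopologicalSpace Z] (P : Z → Prop) : Prop :=
  ∃ G : Set Z, IsGδ G ∧ Dense G ∧ ∀ z ∈ G, P z

/-- The set `B_1(X)` of all contractions of the complex normed space `X`. It is a type synonym, so
that it carries the strong operator topology below and not the operator norm topology. -/
def SOTContraction (X : Type*) [NormedAddCommGroup X] [NormedSpace ℂ X] : Type _ :=
  {T : X →L[ℂ] X // ‖T‖ ≤ 1}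

/-- The bounded operator underlying a contraction. -/
def SOTContraction.toCLM {X : Type*} [NormedAddCommGroup X] [NormedSpace ℂ X]
    (T : SOTContraction X) : X →L[ℂ] X :=
  T.val

/-- The strong operator topology on `B_1(X)`, that is, the topology of pointwise convergence,
induced from Mathlib's space `X →Lₚₜ[ℂ] X`. -/
instance SOTContraction.instTopologicalSpace (X : Type*) [NormedAddCommGroup X]
    [NormedSpace ℂ X] : TopologicalSpace (SOTContraction X) :=
  TopologicalSpace.induced
    (fun T : SOTContraction X =>
      ContinuousLinearMap.toPointwiseConvergenceCLM ℂ (RingHom.id ℂ) X X T.toCLM)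
    inferInstance

/-- The Banach space adjoint `T* : X* → X*`, `T* f = f ∘ T`, on the dual space with its norm. -/
def banachAdjoint {X : Type*} [NormedAddCommGroup X] [NormedSpace ℂ X] (T : X →L[ℂ] X) :
    StrongDual ℂ X →L[ℂ] StrongDual ℂ X :=
  ContinuousLinearMap.precomp ℂ T

/-- An operator is hypercyclic if the orbit `{T ^ n y : n ≥ 0}` of some vector `y` is dense. -/
def IsHypercyclic {Y : Type*} [NormedAddCommGroup Y] [NormedSpace ℂ Y] (T : Y →L[ℂ] Y) : Prop :=
  ∃ y : Y, Dense (Set.range fun n : ℕ => (T ^ n) y)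

end

/-!
By Birkhoff's theorem, `(MT)*` is hypercyclic as soon as, for all functionals `f`, `g` and all
`ε > 0`, some power of `(MT)*` moves a point `ε`-close to `f` to a point `ε`-close to `g`. The dual
of `ℓ_p` is separable and the contractions form a Baire space for the strong operator topology, as
they embed as a closed subset of a countable product of copies of `ℓ_p`
(`SOTContraction.isClosed_range_apply_dense`). Hence it suffices that, for fixed `f`, `g` and `ε`,
the set of such `T` has dense interior (`lp.dense_interior_transfer`). Three facts give this.

* Density (`lp.exists_model_transfer`). Let `f` and `g` be supported on the first `N` coordinates.
  Near any contraction `T` there is a finitely supported contraction `S` and a functional `h` near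
  `f` with `M ^ n • (S*) ^ n h = g`. On the first `N` coordinates `S` is the compression `A` of
  `(1 - c) T` plus `c` times a shift to the next block of `N` coordinates, and it shifts later
  blocks isometrically. The functional `h` is `f` plus a functional on the `n`-th block which
  `(S*) ^ n` carries back to the zeroth block; the latter only has to make up for
  `M⁻ⁿ g - (A*) ^ n f` with `‖A‖ ≤ 1 - c`, so it is small for large `n`.

* Perturbation (`lp.exists_perturbation`). A finitely supported norm-one operator can be moved
  slightly, in operator norm, so that it attains its norm at a finitely supported `x` such that no
  coordinate of `S x` in the relevant range vanishes. It suffices to maximise `‖S' x‖` over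
  matrices `S'` near `S` and `x` in the unit ball.

* Continuity (`lp.tendsto_comp_pow`). At such an `S` the map `T ↦ T*`, and with it `T ↦ (T*) ^ n`,
  is continuous at finitely supported functionals from the strong operator topology to the norm.
  This is where `p > 2` is used. If the unit vectors `x` and `z` have disjoint supports then
  `‖x ± t z‖ ^ p = 1 + t ^ p`, whereas `‖T x + t T z‖ ^ p + ‖T x - t T z‖ ^ p` exceeds
  `2 ‖T x‖ ^ p` by at least a positive multiple of `t ^ 2 |(T z)_k| ^ 2` for each `k` in the support
  of `T x` (`lp.rpow_mul_sq_le`). So if `‖T x‖` is close to `1`, then `(T z)_k` is small uniformly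
  in `z`.

An eigenvector `x` of `T` with eigenvalue `μ` would turn a dense orbit of `(2T)*` into a dense orbit
of multiplication by `2μ` in `ℂ`, which does not exist.
-/

open Filter Topology
open scoped lp

/-! ### The strong operator topology on contractions -/

section SOT

variable {X : Type*} [NormedAddCommGroup X] [NormedSpace ℂ X]

theorem SOTContraction.norm_toCLM_le (T : SOTContraction X) : ‖T.toCLM‖ ≤ 1 := T.property

theorem SOTContraction.norm_apply_le (T : SOTContraction X) (x : X) : ‖T.toCLM x‖ ≤ ‖x‖ := by
  simpa using T.toCLM.le_of_opNorm_le T.norm_toCLM_le x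

theorem SOTContraction.isInducing_apply :
    IsInducing fun (T : SOTContraction X) (x : X) => T.toCLM x :=
  (PointwiseConvergenceCLM.isEmbedding_coeFn (RingHom.id ℂ) X X).isInducing.comp ⟨rfl⟩

theorem SOTContraction.continuous_toCLM_apply (x : X) :
    Continuous fun T : SOTContraction X => T.toCLM x :=
  (continuous_apply x).comp SOTContraction.isInducing_apply.continuous

theorem SOTContraction.tendsto_iff {ι : Type*} {l : Filter ι} {F : ι → SOTContraction X}
    {T : SOTContraction X} :
    Tendsto F l (𝓝 T) ↔ ∀ x, Tendsto (fun i => (F i).toCLM x) l (𝓝 (T.toCLM x)) := by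
  rw [SOTContraction.isInducing_apply.tendsto_nhds_iff, tendsto_pi_nhds]
  rfl

/-- On the unit ball of operators, convergence at the points of a dense sequence already gives
strong convergence. -/
theorem SOTContraction.isInducing_apply_dense {D : ℕ → X} (hD : DenseRange D) :
    IsInducing fun (T : SOTContraction X) (n : ℕ) => T.toCLM (D n) := by
  rw [isInducing_iff_nhds]
  intro T
  apply le_antisymm
  · exact (continuous_pi fun n => SOTContraction.continuous_toCLM_apply (D n)).tendsto T |>.le_comap
  · rw [← tendsto_id', SOTContraction.tendsto_iff]
    intro x
    rw [Metric.tendsto_nhds]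
    intro ε hε
    obtain ⟨n, hn⟩ := hD.exists_dist_lt x (show 0 < ε / 3 by positivity)
    let F : SOTContraction X → ℕ → X := fun S n => S.toCLM (D n)
    have h0 : Tendsto F (comap F (𝓝 (F T))) (𝓝 (F T)) := tendsto_comap
    have h1 := tendsto_pi_nhds.1 h0 n
    filter_upwards [(Metric.tendsto_nhds.1 h1) (ε / 3) (by positivity)] with S hS
    have h2 : ∀ R : SOTContraction X, dist (R.toCLM x) (R.toCLM (D n)) < ε / 3 := fun R => by
      rw [dist_eq_norm, ← map_sub]
      exact (R.norm_apply_le _).trans_lt (by rwa [← dist_eq_norm])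
    have h3 := h2 T
    rw [dist_comm] at h3
    have := dist_triangle4 (S.toCLM x) (S.toCLM (D n)) (T.toCLM (D n)) (T.toCLM x)
    have := h2 S
    simp only [id]
    linarith

/-- The set of contractions is closed for pointwise convergence on a dense sequence. -/
theorem SOTContraction.isClosed_range_apply_dense [CompleteSpace X] {D : ℕ → X}
    (hD : DenseRange D) :
    IsClosed (Set.range fun (T : SOTContraction X) (n : ℕ) => T.toCLM (D n)) := by
  rw [← isSeqClosed_iff_isClosed]
  intro y y₀ hy hlim
  choose T hT using hy
  have hD' : ∀ n, Tendsto (fun k => (T k).toCLM (D n)) atTop (𝓝 (y₀ n)) := fun n => by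
    have := (tendsto_pi_nhds.1 hlim) n
    refine this.congr fun k => ?_
    rw [← hT k]
  have hC : ∀ x, CauchySeq fun k => (T k).toCLM x := fun x => by
    rw [Metric.cauchySeq_iff]
    intro ε hε
    obtain ⟨n, hn⟩ := hD.exists_dist_lt x (show 0 < ε / 3 by positivity)
    obtain ⟨N, hN⟩ := Metric.cauchySeq_iff.1 (hD' n).cauchySeq (ε / 3) (by positivity)
    refine ⟨N, fun k hk l hl => ?_⟩
    have h2 : ∀ k, dist ((T k).toCLM x) ((T k).toCLM (D n)) < ε / 3 := fun k => by
      rw [dist_eq_norm, ← map_sub]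
      exact ((T k).norm_apply_le _).trans_lt (by rwa [← dist_eq_norm])
    have h3 := h2 l
    rw [dist_comm] at h3
    have := dist_triangle4 ((T k).toCLM x) ((T k).toCLM (D n)) ((T l).toCLM (D n)) ((T l).toCLM x)
    have := h2 k
    have := hN k hk l hl
    linarith
  choose L hL using fun x => cauchySeq_tendsto_of_complete (hC x)
  let A : X →ₗ[ℂ] X := linearMapOfTendsto (l := atTop) L (fun k => ((T k).toCLM : X →ₗ[ℂ] X))
    (tendsto_pi_nhds.2 hL)
  have hA : ∀ x, ‖A x‖ ≤ 1 * ‖x‖ := fun x => by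
    rw [one_mul]
    exact le_of_tendsto (hL x).norm (Eventually.of_forall fun k => (T k).norm_apply_le x)
  refine ⟨⟨A.mkContinuous 1 hA, A.mkContinuous_norm_le zero_le_one hA⟩, ?_⟩
  funext n
  exact tendsto_nhds_unique (hL (D n)) (hD' n)

theorem SOTContraction.baireSpace [CompleteSpace X] [TopologicalSpace.SeparableSpace X] :
    BaireSpace (SOTContraction X) := by
  obtain ⟨D, hD⟩ := TopologicalSpace.exists_dense_seq X
  have hind := SOTContraction.isInducing_apply_dense (X := X) hD
  have hinj : Function.Injective fun (T : SOTContraction X) (n : ℕ) => T.toCLM (D n) := by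
    intro S T h
    apply Subtype.ext
    apply ContinuousLinearMap.coeFn_injective
    refine hD.equalizer S.toCLM.continuous T.toCLM.continuous ?_
    funext n
    exact congrFun h n
  have hcl : IsClosedEmbedding fun (T : SOTContraction X) (n : ℕ) => T.toCLM (D n) :=
    ⟨⟨hind, hinj⟩, SOTContraction.isClosed_range_apply_dense hD⟩
  have := hcl.IsCompletelyMetrizableSpace
  infer_instance

end SOT

/-! ### Hypercyclicity -/

section Hypercyclic

/-- Birkhoff's transitivity theorem. -/
theorem isHypercyclic_of_transitive {Y : Type*} [NormedAddCommGroup Y] [NormedSpace ℂ Y]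
    [CompleteSpace Y] [TopologicalSpace.SeparableSpace Y] {R : Y →L[ℂ] Y}
    (hR : ∀ f g : Y, ∀ ε > 0, ∃ (n : ℕ) (h : Y), ‖h - f‖ < ε ∧ ‖(R ^ n) h - g‖ < ε) :
    IsHypercyclic R := by
  obtain ⟨D, hD⟩ := TopologicalSpace.exists_dense_seq Y
  let V : ℕ × ℕ → Set Y := fun jm => {y | ∃ n : ℕ, ‖(R ^ n) y - D jm.1‖ < 1 / ((jm.2 : ℝ) + 1)}
  have hVo : ∀ jm, IsOpen (V jm) := fun jm => by
    have : V jm = ⋃ n : ℕ, {y | ‖(R ^ n) y - D jm.1‖ < 1 / ((jm.2 : ℝ) + 1)} := by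
      ext y; simp [V]
    rw [this]
    refine isOpen_iUnion fun n => isOpen_lt ?_ continuous_const
    fun_prop
  have hVd : ∀ jm, Dense (V jm) := fun jm => by
    rw [Metric.dense_iff]
    intro f r hr
    obtain ⟨n, h, h1, h2⟩ := hR f (D jm.1) (min r (1 / ((jm.2 : ℝ) + 1)))
      (lt_min hr (by positivity))
    refine ⟨h, ?_, n, h2.trans_le (min_le_right _ _)⟩
    rw [mem_ball_iff_norm]
    exact h1.trans_le (min_le_left _ _)
  obtain ⟨y, hy⟩ := (dense_iInter_of_isOpen hVo hVd).nonempty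
  refine ⟨y, ?_⟩
  rw [Metric.dense_iff]
  intro g r hr
  obtain ⟨j, hj⟩ := hD.exists_dist_lt g (half_pos hr)
  obtain ⟨m, hm⟩ := exists_nat_one_div_lt (half_pos hr)
  obtain ⟨n, hn⟩ := Set.mem_iInter.1 hy (j, m)
  refine ⟨(R ^ n) y, ?_, n, rfl⟩
  rw [Metric.mem_ball]
  rw [← dist_eq_norm] at hn
  have := dist_triangle ((R ^ n) y) (D j) g
  rw [dist_comm] at hj
  simp only at hn
  linarith

variable {X : Type*} [NormedAddCommGroup X] [NormedSpace ℂ X]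

set_option synthInstance.maxHeartbeats 200000 in
theorem banachAdjoint_pow_apply (R : X →L[ℂ] X) (n : ℕ) (f : StrongDual ℂ X) :
    (banachAdjoint R ^ n) f = f ∘L (R ^ n) := by
  induction n with
  | zero => ext x; simp
  | succ n ih =>
    rw [pow_succ', mul_apply_eq_comp, ih, pow_succ]
    rfl

/-- Powers of one complex number times a constant are never dense in `ℂ`. -/
theorem not_dense_range_pow_mul (z c : ℂ) : ¬ Dense (Set.range fun n : ℕ => z ^ n * c) := by
  intro h
  rcases le_or_gt ‖z‖ 1 with hz | hz
  · obtain ⟨_, ⟨n, rfl⟩, hn⟩ := h.exists_dist_lt ((‖c‖ + 1 : ℝ) : ℂ) one_pos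
    have h1 : ‖z ^ n * c‖ ≤ ‖c‖ := by
      rw [norm_mul, norm_pow]
      exact mul_le_of_le_one_left (norm_nonneg _) (pow_le_one₀ (norm_nonneg _) hz)
    rw [dist_eq_norm] at hn
    have h2 := norm_sub_norm_le ((‖c‖ + 1 : ℝ) : ℂ) (z ^ n * c)
    rw [Complex.norm_real, Real.norm_of_nonneg (by positivity)] at h2
    linarith
  · rcases eq_or_ne c 0 with rfl | hc
    · obtain ⟨_, ⟨n, rfl⟩, hn⟩ := h.exists_dist_lt 1 one_pos
      simp at hn
    · obtain ⟨_, ⟨n, rfl⟩, hn⟩ := h.exists_dist_lt 0 (norm_pos_iff.2 hc)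
      rw [dist_zero_left, norm_mul, norm_pow] at hn
      have := le_mul_of_one_le_left (norm_nonneg c) (one_le_pow₀ hz.le (n := n))
      linarith

/-- If a nonzero multiple of `T` has a hypercyclic adjoint, then `T` has no eigenvalue: evaluating a
dense orbit at an eigenvector would make the orbit of a scalar under a multiplication dense. -/
theorem not_hasEigenvalue_of_isHypercyclic_adjoint {T : X →L[ℂ] X} {M : ℂ}
    (h : IsHypercyclic (banachAdjoint (M • T))) (μ : ℂ) :
    ¬ Module.End.HasEigenvalue (T : Module.End ℂ X) μ := by
  intro hμ
  obtain ⟨x, hx⟩ := hμ.exists_hasEigenvector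
  have hTx : T x = μ • x := hx.apply_eq_smul
  obtain ⟨f, hf⟩ := h
  obtain ⟨g, hg⟩ := SeparatingDual.exists_eq_one (R := ℂ) hx.2
  have hsurj : Function.Surjective fun φ : StrongDual ℂ X => φ x := fun c =>
    ⟨c • g, by simp [hg]⟩
  have hcont : Continuous fun φ : StrongDual ℂ X => φ x := by fun_prop
  have hd := hsurj.denseRange.dense_image hcont hf
  rw [← Set.range_comp] at hd
  refine not_dense_range_pow_mul (M * μ) (f x) ?_
  convert hd using 3 with n
  simp only [Function.comp_apply, banachAdjoint_pow_apply, ContinuousLinearMap.comp_apply]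
  have : ((M • T) ^ n) x = (M * μ) ^ n • x := by
    induction n with
    | zero => simp
    | succ n ih =>
      rw [pow_succ', mul_apply_eq_comp, ih, map_smul, smul_apply, hTx,
        smul_smul, smul_smul, pow_succ, mul_assoc]
  rw [this, map_smul, smul_eq_mul]

/-- Baire category reduction: it suffices that, for each pair `f`, `g` and each accuracy, the
contractions `T` for which some power of `(MT)*` moves a point near `f` to a point near `g` contain
a dense open set. -/
theorem isTypical_isHypercyclic_adjoint [CompleteSpace X] [TopologicalSpace.SeparableSpace X]
    [TopologicalSpace.SeparableSpace (StrongDual ℂ X)] (M : ℂ)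
    (h : ∀ f g : StrongDual ℂ X, ∀ ε > 0, Dense (interior {T : SOTContraction X |
      ∃ (n : ℕ) (u : StrongDual ℂ X), ‖u - f‖ < ε ∧ ‖M ^ n • (u ∘L T.toCLM ^ n) - g‖ < ε})) :
    IsTypical fun T : SOTContraction X => IsHypercyclic (banachAdjoint (M • T.toCLM)) := by
  have := SOTContraction.baireSpace (X := X)
  obtain ⟨D, hD⟩ := TopologicalSpace.exists_dense_seq (StrongDual ℂ X)
  let O : ℕ × ℕ × ℕ → Set (SOTContraction X) := fun i => interior {T : SOTContraction X |
      ∃ (n : ℕ) (u : StrongDual ℂ X), ‖u - D i.1‖ < 1 / ((i.2.2 : ℝ) + 1) ∧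
        ‖M ^ n • (u ∘L T.toCLM ^ n) - D i.2.1‖ < 1 / ((i.2.2 : ℝ) + 1)}
  refine ⟨⋂ i, O i, IsGδ.iInter_of_isOpen fun _ => isOpen_interior,
    dense_iInter_of_isOpen (fun _ => isOpen_interior) (fun i => h _ _ _ (by positivity)), ?_⟩
  intro T hT
  apply isHypercyclic_of_transitive
  intro f g ε hε
  obtain ⟨i, hi⟩ := hD.exists_dist_lt f (half_pos hε)
  obtain ⟨j, hj⟩ := hD.exists_dist_lt g (half_pos hε)
  obtain ⟨m, hm⟩ := exists_nat_one_div_lt (half_pos hε)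
  obtain ⟨n, u, h1, h2⟩ := interior_subset (Set.mem_iInter.1 hT (i, j, m))
  simp only at h1 h2
  rw [← dist_eq_norm] at h1 h2
  refine ⟨n, u, ?_, ?_⟩
  · rw [← dist_eq_norm]
    have := dist_triangle u (D i) f
    rw [dist_comm] at hi
    linarith
  · rw [← dist_eq_norm, banachAdjoint_pow_apply, smul_pow, ContinuousLinearMap.comp_smul]
    have := dist_triangle (M ^ n • (u ∘L T.toCLM ^ n)) (D j) g
    rw [dist_comm] at hj
    linarith

end Hypercyclic

/-! ### Coordinate operators on `ℓ_p` -/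

section Coordinates

variable {p : ℝ≥0∞}

theorem lp.norm_add_rpow_of_disjoint (hp : 0 < p.toReal) {x y : ℓ^p(ℕ, ℂ)}
    (h : ∀ j, x j = 0 ∨ y j = 0) :
    ‖x + y‖ ^ p.toReal = ‖x‖ ^ p.toReal + ‖y‖ ^ p.toReal := by
  refine (lp.hasSum_norm hp (x + y)).unique ?_
  convert (lp.hasSum_norm hp x).add (lp.hasSum_norm hp y) using 2 with j
  rcases h j with h | h <;> simp [h, Real.zero_rpow hp.ne']

theorem lp.norm_rpow_le_of_injOn (hp : 0 < p.toReal) {A : Set ℕ} {φ : ℕ → ℕ} (hφ : A.InjOn φ)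
    (x : ℓ^p(ℕ, ℂ)) (s : Finset ℕ) :
    ∑ j ∈ s, ‖A.indicator (fun i => x (φ i)) j‖ ^ p.toReal ≤ ‖x‖ ^ p.toReal := by
  classical
  calc ∑ j ∈ s, ‖A.indicator (fun i => x (φ i)) j‖ ^ p.toReal
      = ∑ j ∈ s with j ∈ A, ‖x (φ j)‖ ^ p.toReal := by
        rw [Finset.sum_filter]
        refine Finset.sum_congr rfl fun j _ => ?_
        by_cases hj : j ∈ A <;> simp [hj, Real.zero_rpow hp.ne']
    _ = ∑ i ∈ ({j ∈ s | j ∈ A}).image φ, ‖x i‖ ^ p.toReal := by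
        rw [Finset.sum_image]
        exact hφ.mono fun j hj => (Finset.mem_filter.1 hj).2
    _ ≤ ‖x‖ ^ p.toReal := lp.sum_rpow_le_norm_rpow hp x _

variable [Fact (1 ≤ p)]

/-- The contraction of `ℓ_p` whose value at `x` has coordinates `x (φ j)` for `j ∈ A` and `0` for
`j ∉ A`. Coordinate projections and shifts are of this form. Injectivity of `φ` on
`A` makes it a contraction. -/
noncomputable def lp.compOn (hp : 0 < p.toReal) (A : Set ℕ) (φ : ℕ → ℕ) (hφ : A.InjOn φ) :
    ℓ^p(ℕ, ℂ) →L[ℂ] ℓ^p(ℕ, ℂ) :=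
  LinearMap.mkContinuous
    { toFun := fun x => ⟨A.indicator fun j => x (φ j),
        memℓp_gen' (lp.norm_rpow_le_of_injOn hp hφ x)⟩
      map_add' := fun x y => lp.ext
        (Set.indicator_add A (fun j => x (φ j)) fun j => y (φ j))
      map_smul' := fun c x => lp.ext (Set.indicator_const_smul A c fun j => x (φ j)) }
    1 fun x => by
      rw [one_mul]
      exact lp.norm_le_of_forall_sum_le hp (norm_nonneg _) (lp.norm_rpow_le_of_injOn hp hφ x)

theorem lp.compOn_apply (hp : 0 < p.toReal) {A : Set ℕ} {φ : ℕ → ℕ} (hφ : A.InjOn φ)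
    (x : ℓ^p(ℕ, ℂ)) (j : ℕ) :
    lp.compOn hp A φ hφ x j = A.indicator (fun i => x (φ i)) j := rfl

theorem lp.norm_compOn_apply_le (hp : 0 < p.toReal) {A : Set ℕ} {φ : ℕ → ℕ} (hφ : A.InjOn φ)
    (x : ℓ^p(ℕ, ℂ)) : ‖lp.compOn hp A φ hφ x‖ ≤ ‖x‖ :=
  lp.norm_le_of_forall_sum_le hp (norm_nonneg _) (lp.norm_rpow_le_of_injOn hp hφ x)

/-- The projection of `ℓ_p` onto the first `N` coordinates. -/
noncomputable def lp.coordProj (hp : 0 < p.toReal) (N : ℕ) : ℓ^p(ℕ, ℂ) →L[ℂ] ℓ^p(ℕ, ℂ) :=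
  lp.compOn hp (Set.Iio N) id Function.injective_id.injOn

theorem lp.coordProj_apply (hp : 0 < p.toReal) (N : ℕ) (x : ℓ^p(ℕ, ℂ)) (j : ℕ) :
    lp.coordProj hp N x j = if j < N then x j else 0 := by
  simp [lp.coordProj, lp.compOn_apply, Set.indicator_apply]

theorem lp.norm_coordProj_apply_le (hp : 0 < p.toReal) (N : ℕ) (x : ℓ^p(ℕ, ℂ)) :
    ‖lp.coordProj hp N x‖ ≤ ‖x‖ := lp.norm_compOn_apply_le hp _ x

theorem lp.coordProj_eq_sum (hp : 0 < p.toReal) (N : ℕ) (x : ℓ^p(ℕ, ℂ)) :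
    lp.coordProj hp N x = ∑ j ∈ Finset.range N, x j • lp.single p j (1 : ℂ) := by
  ext i
  rw [lp.coordProj_apply, lp.coeFn_sum, Finset.sum_apply]
  simp [Pi.single_apply]

theorem lp.comp_coordProj_eq_sum (hp : 0 < p.toReal) (N : ℕ) (f : StrongDual ℂ ℓ^p(ℕ, ℂ)) :
    f ∘L lp.coordProj hp N =
      ∑ j ∈ Finset.range N, f (lp.single p j (1 : ℂ)) • lp.evalCLM ℂ (fun _ : ℕ => ℂ) p j := by
  ext x
  rw [ContinuousLinearMap.comp_apply, lp.coordProj_eq_sum, map_sum,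
    sum_apply]
  refine Finset.sum_congr rfl fun j _ => ?_
  rw [map_smul, smul_eq_mul, mul_comm]
  rfl

theorem lp.coordProj_coordProj (hp : 0 < p.toReal) (N : ℕ) (x : ℓ^p(ℕ, ℂ)) :
    lp.coordProj hp N (lp.coordProj hp N x) = lp.coordProj hp N x := by
  ext j
  simp only [lp.coordProj_apply]
  split_ifs <;> rfl

theorem lp.norm_coordProj_rpow_add (hp : 0 < p.toReal) (N : ℕ) (x : ℓ^p(ℕ, ℂ)) :
    ‖lp.coordProj hp N x‖ ^ p.toReal + ‖x - lp.coordProj hp N x‖ ^ p.toReal = ‖x‖ ^ p.toReal := by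
  rw [← lp.norm_add_rpow_of_disjoint hp, add_sub_cancel]
  intro j
  rw [lp.coeFn_sub, Pi.sub_apply, lp.coordProj_apply]
  split_ifs <;> simp

theorem lp.norm_sub_coordProj_le (hp : 0 < p.toReal) (N : ℕ) (x : ℓ^p(ℕ, ℂ)) :
    ‖x - lp.coordProj hp N x‖ ≤ ‖x‖ := by
  rw [← Real.rpow_le_rpow_iff (norm_nonneg _) (norm_nonneg _) hp,
    ← lp.norm_coordProj_rpow_add hp N x]
  exact le_add_of_nonneg_left (by positivity)

theorem lp.tendsto_coordProj (hp : 0 < p.toReal) (x : ℓ^p(ℕ, ℂ)) :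
    Tendsto (fun N => lp.coordProj hp N x) atTop (𝓝 x) := by
  have hp' : p ≠ ⊤ := fun h => by simp [h] at hp
  refine (lp.hasSum_single hp' x).tendsto_sum_nat.congr fun N => ?_
  rw [lp.coordProj_eq_sum]
  refine Finset.sum_congr rfl fun j _ => ?_
  rw [← lp.single_smul, smul_eq_mul, mul_one]

theorem lp.separableSpace (hp : 0 < p.toReal) :
    TopologicalSpace.SeparableSpace ℓ^p(ℕ, ℂ) := by
  have h1 : TopologicalSpace.IsSeparable
      (Set.range fun j : ℕ => (lp.single p j (1 : ℂ) : ℓ^p(ℕ, ℂ))) :=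
    (Set.countable_range _).isSeparable
  rw [← TopologicalSpace.isSeparable_univ_iff]
  refine (h1.span (R := ℂ)).closure.mono fun x _ => ?_
  refine mem_closure_of_tendsto (lp.tendsto_coordProj hp x) (Eventually.of_forall fun N => ?_)
  rw [lp.coordProj_eq_sum]
  exact Submodule.sum_mem _ fun j _ =>
    Submodule.smul_mem _ _ (Submodule.subset_span ⟨j, rfl⟩)

end Coordinates

/-! ### Almost norming vectors in `ℓ_p`, `p > 2` -/

section Norming

variable {p : ℝ≥0∞} [Fact (1 ≤ p)]

theorem Complex.two_mul_rpow_add_le {r : ℝ} (hr : 2 ≤ r) (a b : ℂ) :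
    2 * ‖a‖ ^ r + 2 * (‖a‖ ^ (r - 2) * ‖b‖ ^ 2) ≤ ‖a + b‖ ^ r + ‖a - b‖ ^ r := by
  have hsq : ∀ z : ℂ, ∀ s : ℝ, ‖z‖ ^ s = (‖z‖ ^ 2) ^ (s / 2) := fun z s => by
    rw [← Real.rpow_natCast_mul (norm_nonneg _)]
    congr 1
    push_cast
    ring
  have hpar : ‖a + b‖ ^ 2 + ‖a - b‖ ^ 2 = 2 * (‖a‖ ^ 2 + ‖b‖ ^ 2) := by
    have := parallelogram_law_with_norm ℝ a b
    nlinarith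
  have hconv := (convexOn_rpow (show 1 ≤ r / 2 by linarith)).2
    (show ‖a + b‖ ^ 2 ∈ Set.Ici (0 : ℝ) from sq_nonneg (_ : ℝ))
    (show ‖a - b‖ ^ 2 ∈ Set.Ici (0 : ℝ) from sq_nonneg (_ : ℝ))
    (show (0 : ℝ) ≤ 1 / 2 by norm_num) (show (0 : ℝ) ≤ 1 / 2 by norm_num) (by norm_num)
  simp only [smul_eq_mul] at hconv
  rw [← mul_add, hpar, ← hsq, ← hsq] at hconv
  have hmid : 1 / 2 * (2 * (‖a‖ ^ 2 + ‖b‖ ^ 2)) = ‖a‖ ^ 2 + ‖b‖ ^ 2 := by ring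
  rw [hmid] at hconv
  have hsup : ‖a‖ ^ r + ‖a‖ ^ (r - 2) * ‖b‖ ^ 2 ≤ (‖a‖ ^ 2 + ‖b‖ ^ 2) ^ (r / 2) := by
    have hr2 : r / 2 = (r / 2 - 1) + 1 := by ring
    rw [hsq a r, hsq a (r - 2), show (r - 2) / 2 = r / 2 - 1 by ring, hr2,
      Real.rpow_add_one' (by positivity) (by linarith),
      Real.rpow_add_one' (by positivity) (by linarith), add_sub_cancel_right, ← mul_add]
    gcongr
    · linarith
    · exact le_add_of_nonneg_right (sq_nonneg _)
  linarith

/-- If `x` and `z` have disjoint supports and `R` is a contraction, then wherever `R x` does not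
vanish, `R z` is controlled by the defect `1 - ‖R x‖ ^ p`. This is where `p > 2` enters: `x ± t z`
has norm at most `1 + O(t ^ p)`, while a nonzero coordinate of `R z` on the support of `R x` would
contribute a term of order `t ^ 2`. -/
theorem lp.rpow_mul_sq_le (hp : 2 < p.toReal) {R : ℓ^p(ℕ, ℂ) →L[ℂ] ℓ^p(ℕ, ℂ)}
    (hR : ∀ y, ‖R y‖ ≤ ‖y‖) {x z : ℓ^p(ℕ, ℂ)} (hx : ‖x‖ ≤ 1) (hz : ‖z‖ ≤ 1)
    (hxz : ∀ j, x j = 0 ∨ z j = 0) {t : ℝ} (ht : 0 < t) (k : ℕ) :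
    ‖R x k‖ ^ (p.toReal - 2) * (t ^ 2 * ‖R z k‖ ^ 2) ≤ t ^ p.toReal + (1 - ‖R x‖ ^ p.toReal) := by
  have hp0 : 0 < p.toReal := by linarith
  have hbound : ∀ s : ℝ, |s| = t → ‖R x + R ((s : ℂ) • z)‖ ^ p.toReal ≤ 1 + t ^ p.toReal := by
    intro s hs
    rw [← map_add]
    calc ‖R (x + (s : ℂ) • z)‖ ^ p.toReal ≤ ‖x + (s : ℂ) • z‖ ^ p.toReal := by
          gcongr
          exact hR _
      _ = ‖x‖ ^ p.toReal + ‖(s : ℂ) • z‖ ^ p.toReal := by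
          refine lp.norm_add_rpow_of_disjoint hp0 fun j => ?_
          rw [lp.coeFn_smul, Pi.smul_apply, smul_eq_zero]
          exact (hxz j).imp_right Or.inr
      _ ≤ 1 + t ^ p.toReal := by
          rw [norm_smul, Complex.norm_real, Real.norm_eq_abs, hs]
          gcongr
          · exact Real.rpow_le_one (norm_nonneg _) hx hp0.le
          · exact mul_le_of_le_one_right ht.le hz
  have h1 := hbound t (abs_of_pos ht)
  have h2 := hbound (-t) (by rw [abs_neg, abs_of_pos ht])
  rw [Complex.ofReal_neg, neg_smul, map_neg, ← sub_eq_add_neg] at h2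
  have hsum := (((lp.hasSum_norm hp0 (R x + R ((t : ℂ) • z))).add
    (lp.hasSum_norm hp0 (R x - R ((t : ℂ) • z)))).sub ((lp.hasSum_norm hp0 (R x)).mul_left 2))
  have hterm : ∀ j, 2 * (‖R x j‖ ^ (p.toReal - 2) * (t ^ 2 * ‖R z j‖ ^ 2)) ≤
      ‖(R x + R ((t : ℂ) • z)) j‖ ^ p.toReal + ‖(R x - R ((t : ℂ) • z)) j‖ ^ p.toReal -
        2 * ‖R x j‖ ^ p.toReal := fun j => by
    have := Complex.two_mul_rpow_add_le hp.le (R x j) ((t : ℂ) * R z j)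
    rw [norm_mul, Complex.norm_real, Real.norm_eq_abs, mul_pow, sq_abs] at this
    simp only [lp.coeFn_add, lp.coeFn_sub, map_smul, lp.coeFn_smul, Pi.add_apply, Pi.sub_apply,
      Pi.smul_apply, smul_eq_mul]
    linarith
  have hk := le_hasSum hsum k fun j _ => le_trans (by positivity) (hterm j)
  have := hterm k
  linarith

theorem Real.exists_pos_rpow_lt {r δ : ℝ} (hr : 0 < r) (hδ : 0 < δ) : ∃ t > 0, t ^ r < δ := by
  refine ⟨(δ / 2) ^ r⁻¹, by positivity, ?_⟩
  rw [Real.rpow_inv_rpow (by positivity) hr.ne']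
  linarith

/-- The finitely supported functionals are dense in the dual of `ℓ_p`. -/
theorem lp.tendsto_comp_coordProj (hp : 2 < p.toReal) (hp0 : 0 < p.toReal)
    (f : StrongDual ℂ ℓ^p(ℕ, ℂ)) :
    Tendsto (fun N => f ∘L lp.coordProj hp0 N) atTop (𝓝 f) := by
  rcases eq_or_ne f 0 with rfl | hf
  · simp
  rw [Metric.tendsto_atTop]
  intro ε hε
  have hA : 0 < ‖f‖ ^ 2 + 1 := by positivity
  obtain ⟨t, ht, htε⟩ := Real.exists_pos_rpow_lt (show 0 < p.toReal - 2 by linarith)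
    (show 0 < (ε / 2) ^ 2 / (‖f‖ ^ 2 + 1) by positivity)
  rw [lt_div_iff₀ hA] at htε
  have htp : t ^ p.toReal = t ^ (p.toReal - 2) * t ^ 2 := by
    rw [← Real.rpow_natCast t 2, ← Real.rpow_add ht]
    norm_num
  have htp0 : 0 < t ^ p.toReal := by positivity
  -- a finitely supported vector of the unit ball at which `f` almost attains its norm
  obtain ⟨x, hx1, hx2⟩ : ∃ x, ‖x‖ < 1 ∧ √(‖f‖ ^ 2 - t ^ p.toReal) < ‖f x‖ := by
    refine f.exists_lt_apply_of_lt_opNorm ?_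
    rw [Real.sqrt_lt' (norm_pos_iff.2 hf)]
    linarith
  have hx3 : Tendsto (fun N => √(‖f‖ ^ 2 - t ^ p.toReal) - ‖f (lp.coordProj hp0 N x)‖) atTop
      (𝓝 (√(‖f‖ ^ 2 - t ^ p.toReal) - ‖f x‖)) :=
    tendsto_const_nhds.sub ((f.continuous.tendsto x).comp (lp.tendsto_coordProj hp0 x)).norm
  obtain ⟨K, hK⟩ := (hx3.eventually_lt_const (sub_neg.2 hx2)).exists
  have hfx := Real.lt_sq_of_sqrt_lt (sub_neg.1 hK)
  set x' := lp.coordProj hp0 K x with hx'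
  have hx'1 : ‖x'‖ ≤ 1 := (lp.norm_coordProj_apply_le hp0 K x).trans hx1.le
  refine ⟨K, fun N hN => ?_⟩
  rw [dist_eq_norm]
  refine lt_of_le_of_lt ?_ (half_lt_self hε)
  refine ContinuousLinearMap.opNorm_le_of_unit_norm (by positivity) fun y hy => ?_
  set z := y - lp.coordProj hp0 N y with hz
  have hz1 : ‖z‖ ≤ 1 := (lp.norm_sub_coordProj_le hp0 N y).trans hy.le
  have hxz : ∀ j, x' j = 0 ∨ z j = 0 := fun j => by
    rw [hx', hz, lp.coeFn_sub, Pi.sub_apply, lp.coordProj_apply, lp.coordProj_apply]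
    by_cases hj : j < K
    · right
      rw [if_pos (hj.trans_le hN), sub_self]
    · left
      rw [if_neg hj]
  have hbound : ∀ s : ℝ, |s| = t → ‖f x' + (s : ℂ) * f z‖ ^ 2 ≤ ‖f‖ ^ 2 * (1 + t ^ p.toReal) := by
    intro s hs
    have h1 : ‖x' + (s : ℂ) • z‖ ^ p.toReal ≤ 1 + t ^ p.toReal := by
      rw [lp.norm_add_rpow_of_disjoint hp0, norm_smul, Complex.norm_real, Real.norm_eq_abs, hs]
      · gcongr
        · exact Real.rpow_le_one (norm_nonneg _) hx'1 hp0.le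
        · exact mul_le_of_le_one_right ht.le hz1
      · intro j
        rw [lp.coeFn_smul, Pi.smul_apply, smul_eq_zero]
        exact (hxz j).imp_right Or.inr
    have h2 : ‖x' + (s : ℂ) • z‖ ^ 2 ≤ 1 + t ^ p.toReal := by
      rcases le_total ‖x' + (s : ℂ) • z‖ 1 with h | h
      · exact (pow_le_one₀ (norm_nonneg _) h).trans (by linarith)
      · refine le_trans ?_ h1
        rw [← Real.rpow_natCast]
        exact Real.rpow_le_rpow_of_exponent_le h (by exact_mod_cast hp.le)
    have h3 : f x' + (s : ℂ) * f z = f (x' + (s : ℂ) • z) := by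
      rw [map_add, map_smul, smul_eq_mul]
    rw [h3]
    calc ‖f (x' + (s : ℂ) • z)‖ ^ 2 ≤ (‖f‖ * ‖x' + (s : ℂ) • z‖) ^ 2 := by
          gcongr
          exact f.le_opNorm _
      _ = ‖f‖ ^ 2 * ‖x' + (s : ℂ) • z‖ ^ 2 := by ring
      _ ≤ ‖f‖ ^ 2 * (1 + t ^ p.toReal) := by gcongr
  have h1 := hbound t (abs_of_pos ht)
  have h2 := hbound (-t) (by rw [abs_neg, abs_of_pos ht])
  rw [Complex.ofReal_neg, neg_mul, ← sub_eq_add_neg] at h2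
  have hpar := parallelogram_law_with_norm ℝ (f x') ((t : ℂ) * f z)
  have hn : ‖(t : ℂ) * f z‖ = t * ‖f z‖ := by
    rw [norm_mul, Complex.norm_real, Real.norm_of_nonneg ht.le]
  rw [hn] at hpar
  have h4 : t ^ 2 * ‖f z‖ ^ 2 ≤ t ^ 2 * (t ^ (p.toReal - 2) * (‖f‖ ^ 2 + 1)) := by
    have : t ^ 2 * (t ^ (p.toReal - 2) * (‖f‖ ^ 2 + 1)) = t ^ p.toReal * (‖f‖ ^ 2 + 1) := by
      rw [htp]; ring
    rw [this]
    nlinarith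
  have h5 := le_of_mul_le_mul_left h4 (by positivity)
  have h6 : ‖f z‖ ≤ ε / 2 := by
    rw [← sq_le_sq₀ (norm_nonneg _) (by positivity)]
    linarith
  have h7 : (f ∘L lp.coordProj hp0 N - f) y = -f z := by
    rw [hz, map_sub]
    simp
  rw [h7, _root_.norm_neg]
  exact h6

theorem lp.separableSpace_dual (hp : 2 < p.toReal) :
    TopologicalSpace.SeparableSpace (StrongDual ℂ ℓ^p(ℕ, ℂ)) := by
  have hp0 : 0 < p.toReal := by linarith
  have h1 : TopologicalSpace.IsSeparable
      (Set.range fun j : ℕ => lp.evalCLM ℂ (fun _ : ℕ => ℂ) p j) :=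
    (Set.countable_range _).isSeparable
  rw [← TopologicalSpace.isSeparable_univ_iff]
  refine (h1.span (R := ℂ)).closure.mono fun f _ => ?_
  refine mem_closure_of_tendsto (lp.tendsto_comp_coordProj hp hp0 f)
    (Eventually.of_forall fun N => ?_)
  rw [lp.comp_coordProj_eq_sum]
  exact Submodule.sum_mem _ fun j _ =>
    Submodule.smul_mem _ _ (Submodule.subset_span ⟨j, rfl⟩)

end Norming

/-! ### Norm continuity of the adjoint -/

section Continuity

variable {p : ℝ≥0∞} [Fact (1 ≤ p)]

/-- Contractions close to `S`, with `S` attaining its norm at `x`, nearly annihilate the `k`-th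
coordinate of vectors supported off `x`, provided the `k`-th coordinate of `S x` is nonzero. -/
theorem lp.eventually_norm_apply_le (hp : 2 < p.toReal) {S : SOTContraction ℓ^p(ℕ, ℂ)} {K : ℕ}
    {x : ℓ^p(ℕ, ℂ)} (hxK : ∀ j, K ≤ j → x j = 0) (hx : ‖x‖ ≤ 1) (hSx : ‖S.toCLM x‖ = 1) {k : ℕ}
    (hk : S.toCLM x k ≠ 0) {ε : ℝ} (hε : 0 < ε) :
    ∀ᶠ T in 𝓝 S, ∀ z : ℓ^p(ℕ, ℂ), ‖z‖ ≤ 1 → (∀ j < K, z j = 0) → ‖T.toCLM z k‖ ≤ ε := by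
  have hp0 : 0 < p.toReal := by linarith
  set α := ‖S.toCLM x k‖ ^ (p.toReal - 2) with hα
  have hα0 : 0 < α := Real.rpow_pos_of_pos (norm_pos_iff.2 hk) _
  obtain ⟨t, ht, htε⟩ := Real.exists_pos_rpow_lt (show 0 < p.toReal - 2 by linarith)
    (show 0 < α * ε ^ 2 / 4 by positivity)
  have hc : Continuous fun T : SOTContraction ℓ^p(ℕ, ℂ) => T.toCLM x :=
    SOTContraction.continuous_toCLM_apply x
  have h1 : ∀ᶠ T : SOTContraction ℓ^p(ℕ, ℂ) in 𝓝 S,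
      α / 2 < ‖T.toCLM x k‖ ^ (p.toReal - 2) := by
    have hc1 : Continuous fun T : SOTContraction ℓ^p(ℕ, ℂ) => ‖T.toCLM x k‖ ^ (p.toReal - 2) :=
      (((lp.evalCLM ℂ (fun _ : ℕ => ℂ) p k).continuous.comp hc).norm).rpow_const
        fun _ => Or.inr (by linarith)
    exact (hc1.tendsto S).eventually_const_lt (half_lt_self hα0)
  have h2 : ∀ᶠ T : SOTContraction ℓ^p(ℕ, ℂ) in 𝓝 S,
      1 - ‖T.toCLM x‖ ^ p.toReal < t ^ 2 * (α * ε ^ 2 / 4) := by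
    have hc2 : Continuous fun T : SOTContraction ℓ^p(ℕ, ℂ) => 1 - ‖T.toCLM x‖ ^ p.toReal :=
      continuous_const.sub (hc.norm.rpow_const fun _ => Or.inr hp0.le)
    refine (hc2.tendsto S).eventually_lt_const ?_
    rw [hSx, Real.one_rpow, sub_self]
    positivity
  filter_upwards [h1, h2] with T hT1 hT2 z hz hzK
  have hxz : ∀ j, x j = 0 ∨ z j = 0 := fun j => by
    rcases lt_or_ge j K with h | h
    · exact Or.inr (hzK j h)
    · exact Or.inl (hxK j h)
  have h3 := lp.rpow_mul_sq_le hp T.norm_apply_le hx hz hxz ht k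
  have htp : t ^ p.toReal = t ^ (p.toReal - 2) * t ^ 2 := by
    rw [← Real.rpow_natCast t 2, ← Real.rpow_add ht]
    norm_num
  have h4 : α / 2 * (t ^ 2 * ‖T.toCLM z k‖ ^ 2) ≤ α / 2 * (t ^ 2 * ε ^ 2) := by
    calc α / 2 * (t ^ 2 * ‖T.toCLM z k‖ ^ 2)
        ≤ ‖T.toCLM x k‖ ^ (p.toReal - 2) * (t ^ 2 * ‖T.toCLM z k‖ ^ 2) := by gcongr
      _ ≤ t ^ (p.toReal - 2) * t ^ 2 + (1 - ‖T.toCLM x‖ ^ p.toReal) := by rw [← htp]; exact h3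
      _ ≤ α * ε ^ 2 / 4 * t ^ 2 + t ^ 2 * (α * ε ^ 2 / 4) := by gcongr
      _ = α / 2 * (t ^ 2 * ε ^ 2) := by ring
  have h5 := le_of_mul_le_mul_left (le_of_mul_le_mul_left h4 (by positivity)) (by positivity)
  exact (sq_le_sq₀ (norm_nonneg _) hε.le).1 h5

/-- If `S` attains its norm at a finitely supported `x`, then `T ↦ T* e_k*` is continuous at `S`
from the strong operator topology to the norm topology, for each `k` in the support of `S x`. -/
theorem lp.tendsto_evalCLM_comp (hp : 2 < p.toReal) {S : SOTContraction ℓ^p(ℕ, ℂ)} {K : ℕ}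
    {x : ℓ^p(ℕ, ℂ)} (hxK : ∀ j, K ≤ j → x j = 0) (hx : ‖x‖ ≤ 1) (hSx : ‖S.toCLM x‖ = 1) {k : ℕ}
    (hk : S.toCLM x k ≠ 0) :
    Tendsto (fun T : SOTContraction ℓ^p(ℕ, ℂ) => lp.evalCLM ℂ (fun _ : ℕ => ℂ) p k ∘L T.toCLM)
      (𝓝 S) (𝓝 (lp.evalCLM ℂ (fun _ : ℕ => ℂ) p k ∘L S.toCLM)) := by
  have hp0 : 0 < p.toReal := by linarith
  have hpne : p ≠ 0 := (zero_lt_one.trans_le (Fact.out : 1 ≤ p)).ne'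
  rw [Metric.tendsto_nhds]
  intro ε hε
  have h1 := lp.eventually_norm_apply_le hp hxK hx hSx hk (show 0 < ε / 4 by positivity)
  have h2 : ∀ᶠ T : SOTContraction ℓ^p(ℕ, ℂ) in 𝓝 S,
      ∑ j ∈ Finset.range K, ‖T.toCLM (lp.single p j (1 : ℂ)) - S.toCLM (lp.single p j (1 : ℂ))‖
        < ε / 4 := by
    have hc : Continuous fun T : SOTContraction ℓ^p(ℕ, ℂ) => ∑ j ∈ Finset.range K,
        ‖T.toCLM (lp.single p j (1 : ℂ)) - S.toCLM (lp.single p j (1 : ℂ))‖ :=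
      continuous_finsetSum _ fun j _ =>
        ((SOTContraction.continuous_toCLM_apply _).sub continuous_const).norm
    refine (hc.tendsto S).eventually_lt_const ?_
    simpa using hε
  filter_upwards [h1, h2] with T hT1 hT2
  rw [dist_eq_norm]
  refine lt_of_le_of_lt ?_ (show 3 * (ε / 4) < ε by linarith)
  refine ContinuousLinearMap.opNorm_le_of_unit_norm (by positivity) fun y hy => ?_
  set z := y - lp.coordProj hp0 K y with hz
  have hz1 : ‖z‖ ≤ 1 := (lp.norm_sub_coordProj_le hp0 K y).trans hy.le
  have hzK : ∀ j < K, z j = 0 := fun j hj => by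
    rw [hz, lp.coeFn_sub, Pi.sub_apply, lp.coordProj_apply, if_pos hj, sub_self]
  have hy' : y = lp.coordProj hp0 K y + z := by rw [hz]; abel
  have h3 : (lp.evalCLM ℂ (fun _ : ℕ => ℂ) p k ∘L T.toCLM -
      lp.evalCLM ℂ (fun _ : ℕ => ℂ) p k ∘L S.toCLM) y =
      (T.toCLM (lp.coordProj hp0 K y) - S.toCLM (lp.coordProj hp0 K y)) k +
        T.toCLM z k - S.toCLM z k := by
    conv_lhs => rw [hy']
    change (T.toCLM (lp.coordProj hp0 K y + z)) k - (S.toCLM (lp.coordProj hp0 K y + z)) k = _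
    rw [map_add, map_add, lp.coeFn_add, lp.coeFn_add, lp.coeFn_sub, Pi.add_apply, Pi.add_apply,
      Pi.sub_apply]
    ring
  have h4 : ‖T.toCLM (lp.coordProj hp0 K y) - S.toCLM (lp.coordProj hp0 K y)‖ ≤ ε / 4 := by
    refine le_trans ?_ hT2.le
    rw [lp.coordProj_eq_sum, map_sum, map_sum, ← Finset.sum_sub_distrib]
    refine (norm_sum_le _ _).trans (Finset.sum_le_sum fun j _ => ?_)
    rw [map_smul, map_smul, ← smul_sub, norm_smul]
    exact mul_le_of_le_one_left (norm_nonneg _) ((lp.norm_apply_le_norm hpne y j).trans hy.le)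
  rw [h3]
  have h5 := lp.norm_apply_le_norm hpne
    (T.toCLM (lp.coordProj hp0 K y) - S.toCLM (lp.coordProj hp0 K y)) k
  have h6 := hT1 z hz1 hzK
  have h7 := h1.self_of_nhds z hz1 hzK
  have h8 := norm_sub_le ((T.toCLM (lp.coordProj hp0 K y) - S.toCLM (lp.coordProj hp0 K y)) k +
        T.toCLM z k) (S.toCLM z k)
  have h9 := norm_add_le ((T.toCLM (lp.coordProj hp0 K y) - S.toCLM (lp.coordProj hp0 K y)) k)
    (T.toCLM z k)
  linarith

/-- Let `S` be supported on the first `K` coordinates and attain its norm at a vector whose image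
has all of its first `K` coordinates nonzero. Then `T ↦ (T*)ⁿ h` is continuous at `S`, from the
strong operator topology to the norm topology, for each `h` supported on these coordinates. -/
theorem lp.tendsto_comp_pow (hp : 2 < p.toReal) (hp0 : 0 < p.toReal)
    {S : SOTContraction ℓ^p(ℕ, ℂ)} {K : ℕ} (hSK : S.toCLM ∘L lp.coordProj hp0 K = S.toCLM)
    {x : ℓ^p(ℕ, ℂ)} (hxK : ∀ j, K ≤ j → x j = 0) (hx : ‖x‖ ≤ 1) (hSx : ‖S.toCLM x‖ = 1)
    (hk : ∀ k < K, S.toCLM x k ≠ 0) {h : StrongDual ℂ ℓ^p(ℕ, ℂ)}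
    (hh : h ∘L lp.coordProj hp0 K = h) (n : ℕ) :
    Tendsto (fun T : SOTContraction ℓ^p(ℕ, ℂ) => h ∘L T.toCLM ^ n) (𝓝 S)
      (𝓝 (h ∘L S.toCLM ^ n)) := by
  have key : ∀ φ : StrongDual ℂ ℓ^p(ℕ, ℂ), φ ∘L lp.coordProj hp0 K = φ →
      Tendsto (fun T : SOTContraction ℓ^p(ℕ, ℂ) => φ ∘L T.toCLM) (𝓝 S) (𝓝 (φ ∘L S.toCLM)) := by
    intro φ hφ
    have hsum : ∀ T : SOTContraction ℓ^p(ℕ, ℂ), φ ∘L T.toCLM =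
        ∑ k ∈ Finset.range K, φ (lp.single p k (1 : ℂ)) •
          (lp.evalCLM ℂ (fun _ : ℕ => ℂ) p k ∘L T.toCLM) := fun T => by
      have hφ' := lp.comp_coordProj_eq_sum hp0 K φ
      rw [hφ] at hφ'
      ext y
      refine (DFunLike.congr_fun hφ' (T.toCLM y)).trans ?_
      simp only [ContinuousLinearMap.comp_apply, sum_apply, smul_apply]
    simp only [hsum]
    exact tendsto_finsetSum _ fun k hkK =>
      (lp.tendsto_evalCLM_comp hp hxK hx hSx (hk k (Finset.mem_range.1 hkK))).const_smul _
  induction n with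
  | zero => simp
  | succ n ih =>
    have hψ : (h ∘L S.toCLM ^ n) ∘L lp.coordProj hp0 K = h ∘L S.toCLM ^ n := by
      cases n with
      | zero => exact hh
      | succ m =>
        rw [pow_succ, ContinuousLinearMap.comp_assoc]
        change h ∘L ((S.toCLM ^ m) ∘L (S.toCLM ∘L lp.coordProj hp0 K)) = _
        rw [hSK]
        rfl
    have h1 := key _ hψ
    have h2 : Tendsto (fun T : SOTContraction ℓ^p(ℕ, ℂ) =>
        (h ∘L T.toCLM ^ n - h ∘L S.toCLM ^ n) ∘L T.toCLM) (𝓝 S) (𝓝 0) := by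
      refine squeeze_zero_norm (fun T => ?_) (tendsto_iff_norm_sub_tendsto_zero.1 ih)
      exact (ContinuousLinearMap.opNorm_comp_le _ _).trans
        (mul_le_of_le_one_right (norm_nonneg _) T.norm_toCLM_le)
    have h3 := h2.add h1
    rw [zero_add] at h3
    refine (h3.congr fun T => ?_)
    rw [ContinuousLinearMap.sub_comp, sub_add_cancel, pow_succ]
    rfl

end Continuity

/-! ### Perturbing a matrix so that a norming vector has an image of full support -/

section Perturbation

variable {p : ℝ≥0∞} [Fact (1 ≤ p)]

/-- The operator on `ℓ_p` whose matrix is `t` on the first `K` coordinates and zero elsewhere. -/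
noncomputable def lp.ofMatrix (p : ℝ≥0∞) [Fact (1 ≤ p)] {K : ℕ} (t : Fin K → Fin K → ℂ) :
    ℓ^p(ℕ, ℂ) →L[ℂ] ℓ^p(ℕ, ℂ) :=
  ∑ k, ∑ j, t k j • (lp.evalCLM ℂ (fun _ : ℕ => ℂ) p (j : ℕ)).smulRight
    (lp.single p (k : ℕ) (1 : ℂ))

theorem lp.ofMatrix_apply {K : ℕ} (t : Fin K → Fin K → ℂ) (x : ℓ^p(ℕ, ℂ)) :
    lp.ofMatrix p t x = ∑ k, ∑ j, (t k j * x j) • lp.single p (k : ℕ) (1 : ℂ) := by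
  simp only [lp.ofMatrix, sum_apply, smul_apply, ContinuousLinearMap.smulRight_apply, smul_smul]
  rfl

theorem lp.ofMatrix_zero {K : ℕ} :
    (lp.ofMatrix p (0 : Fin K → Fin K → ℂ) : ℓ^p(ℕ, ℂ) →L[ℂ] ℓ^p(ℕ, ℂ)) = 0 := by
  simp [lp.ofMatrix]

theorem lp.ofMatrix_add {K : ℕ} (s t : Fin K → Fin K → ℂ) :
    (lp.ofMatrix p (s + t) : ℓ^p(ℕ, ℂ) →L[ℂ] ℓ^p(ℕ, ℂ)) = lp.ofMatrix p s + lp.ofMatrix p t := by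
  simp [lp.ofMatrix, add_smul, Finset.sum_add_distrib]

theorem lp.ofMatrix_single_apply {K : ℕ} (k j : Fin K) (s : ℂ) (x : ℓ^p(ℕ, ℂ)) :
    lp.ofMatrix p (Pi.single k (Pi.single j s)) x = (s * x j) • lp.single p (k : ℕ) (1 : ℂ) := by
  rw [lp.ofMatrix_apply, Finset.sum_eq_single k, Finset.sum_eq_single j]
  · simp
  · intro i _ hi
    simp [hi]
  · simp
  · intro i _ hi
    simp [hi]
  · simp

theorem lp.continuous_ofMatrix {K : ℕ} :
    Continuous fun t : Fin K → Fin K → ℂ => (lp.ofMatrix p t : ℓ^p(ℕ, ℂ) →L[ℂ] ℓ^p(ℕ, ℂ)) := by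
  unfold lp.ofMatrix
  refine continuous_finsetSum _ fun k _ => continuous_finsetSum _ fun j _ => ?_
  exact (continuous_apply_apply k j).smul continuous_const

theorem lp.ofMatrix_coordProj (hp : 0 < p.toReal) {K : ℕ} (t : Fin K → Fin K → ℂ)
    (x : ℓ^p(ℕ, ℂ)) : lp.ofMatrix p t (lp.coordProj hp K x) = lp.ofMatrix p t x := by
  simp [lp.ofMatrix_apply, lp.coordProj_apply]

/-- If a coordinate of the image of `x ≠ 0` vanishes, then changing one matrix entry in the
corresponding row, within the allowed range, increases the norm of the image. -/
theorem lp.exists_norm_lt_of_apply_eq_zero (hp : 0 < p.toReal) {K : ℕ}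
    {S : ℓ^p(ℕ, ℂ) →L[ℂ] ℓ^p(ℕ, ℂ)} {t : Fin K → Fin K → ℂ} {δ : ℝ} (hδ : 0 < δ) (ht : ‖t‖ ≤ δ)
    {x : ℓ^p(ℕ, ℂ)} {k j : Fin K} (h0 : (S + lp.ofMatrix p t) x k = 0) (hj : x j ≠ 0) :
    ∃ t' : Fin K → Fin K → ℂ, ‖t'‖ ≤ δ ∧
      ‖(S + lp.ofMatrix p t) x‖ < ‖(S + lp.ofMatrix p t') x‖ := by
  obtain ⟨c, hc, hct⟩ : ∃ c : ℂ, ‖c‖ ≤ δ ∧ c ≠ t k j := by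
    by_cases h : t k j = 0
    · refine ⟨(δ : ℂ), ?_, ?_⟩
      · rw [Complex.norm_real, Real.norm_of_nonneg hδ.le]
      · rw [h, Complex.ofReal_ne_zero]
        exact hδ.ne'
    · exact ⟨0, by simpa using hδ.le, fun h' => h h'.symm⟩
  refine ⟨t + Pi.single k (Pi.single j (c - t k j)), ?_, ?_⟩
  · rw [pi_norm_le_iff_of_nonneg hδ.le]
    intro i
    rw [pi_norm_le_iff_of_nonneg hδ.le]
    intro l
    rw [Pi.add_apply, Pi.add_apply]
    rcases eq_or_ne i k with rfl | hi
    · rcases eq_or_ne l j with rfl | hl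
      · simpa using hc
      · simpa [hl] using (norm_le_pi_norm (t i) l).trans ((norm_le_pi_norm t i).trans ht)
    · simpa [hi] using (norm_le_pi_norm (t i) l).trans ((norm_le_pi_norm t i).trans ht)
  · rw [lp.ofMatrix_add, ← add_assoc, add_apply _ (lp.ofMatrix p (Pi.single _ _)),
      lp.ofMatrix_single_apply, ← Real.rpow_lt_rpow_iff (norm_nonneg _) (norm_nonneg _) hp,
      lp.norm_add_rpow_of_disjoint hp, norm_smul, lp.norm_single (zero_lt_one.trans_le Fact.out),
      norm_one, mul_one]
    · have h2 : 0 < ‖(c - t k j) * x j‖ ^ p.toReal :=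
        Real.rpow_pos_of_pos (norm_pos_iff.2 (mul_ne_zero (sub_ne_zero.2 hct) hj)) _
      linarith
    · intro i
      rcases eq_or_ne i k with rfl | hi
      · exact Or.inl h0
      · right
        rw [lp.coeFn_smul, Pi.smul_apply, lp.single_apply, Pi.single_eq_of_ne hi, smul_zero]

/-- Over matrices with bounded entries and vectors in the unit ball, the norm of the image of the
vector attains its maximum, and it does so at a vector supported on the first `K` coordinates. -/
theorem lp.exists_forall_norm_apply_le (hp : 0 < p.toReal) {S : ℓ^p(ℕ, ℂ) →L[ℂ] ℓ^p(ℕ, ℂ)} {K : ℕ}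
    (hSK : S ∘L lp.coordProj hp K = S) {δ : ℝ} (hδ : 0 < δ) :
    ∃ (t : Fin K → Fin K → ℂ) (x : ℓ^p(ℕ, ℂ)), ‖t‖ ≤ δ ∧ ‖x‖ ≤ 1 ∧ (∀ j, K ≤ j → x j = 0) ∧
      ∀ (s : Fin K → Fin K → ℂ) (y : ℓ^p(ℕ, ℂ)), ‖s‖ ≤ δ → ‖y‖ ≤ 1 →
        ‖(S + lp.ofMatrix p s) y‖ ≤ ‖(S + lp.ofMatrix p t) x‖ := by
  have hpne : p ≠ 0 := (zero_lt_one.trans_le (Fact.out : 1 ≤ p)).ne'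
  let V : (Fin K → ℂ) → ℓ^p(ℕ, ℂ) := fun a => ∑ j, a j • lp.single p (j : ℕ) (1 : ℂ)
  have hVc : Continuous V := by
    refine continuous_finsetSum _ fun j _ => ?_
    exact (continuous_apply j).smul continuous_const
  have hVj : ∀ (a : Fin K → ℂ) (j : Fin K), V a j = a j := fun a j => by
    simp only [V, lp.coeFn_sum, Finset.sum_apply, lp.coeFn_smul, Pi.smul_apply,
      lp.single_apply, smul_eq_mul]
    rw [Finset.sum_eq_single j]
    · simp
    · intro i _ hi
      rw [Pi.single_eq_of_ne (fun h => hi (Fin.ext h.symm)), mul_zero]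
    · simp
  have hVK : ∀ (a : Fin K → ℂ) (j : ℕ), K ≤ j → V a j = 0 := fun a j hj => by
    simp only [V, lp.coeFn_sum, Finset.sum_apply, lp.coeFn_smul, Pi.smul_apply,
      lp.single_apply, smul_eq_mul]
    refine Finset.sum_eq_zero fun i _ => ?_
    rw [Pi.single_eq_of_ne (by have := i.2; omega), mul_zero]
  have hVQ : ∀ y : ℓ^p(ℕ, ℂ), lp.coordProj hp K y = V fun j => y j := fun y => by
    ext j
    rw [lp.coordProj_apply]
    split_ifs with h
    · exact (hVj (fun j => y j) ⟨j, h⟩).symm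
    · exact (hVK _ _ (not_lt.1 h)).symm
  have hcomp : IsCompact (Metric.closedBall (0 : Fin K → Fin K → ℂ) δ ×ˢ {a | ‖V a‖ ≤ 1}) := by
    refine (isCompact_closedBall _ _).prod ?_
    refine (isCompact_closedBall (0 : Fin K → ℂ) 1).of_isClosed_subset
      (isClosed_le hVc.norm continuous_const) fun a ha => ?_
    rw [mem_closedBall_zero_iff, pi_norm_le_iff_of_nonneg zero_le_one]
    intro j
    rw [← hVj a j]
    exact (lp.norm_apply_le_norm hpne _ _).trans ha
  have hne : ((0 : Fin K → Fin K → ℂ), (0 : Fin K → ℂ)) ∈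
      Metric.closedBall (0 : Fin K → Fin K → ℂ) δ ×ˢ {a | ‖V a‖ ≤ 1} := by
    refine ⟨Metric.mem_closedBall_self hδ.le, ?_⟩
    simp [V]
  have hFc : Continuous fun q : (Fin K → Fin K → ℂ) × (Fin K → ℂ) =>
      ‖(S + (lp.ofMatrix p q.1 : ℓ^p(ℕ, ℂ) →L[ℂ] ℓ^p(ℕ, ℂ))) (V q.2)‖ := by
    have h1 : Continuous fun q : (Fin K → Fin K → ℂ) × (Fin K → ℂ) =>
        S + (lp.ofMatrix p q.1 : ℓ^p(ℕ, ℂ) →L[ℂ] ℓ^p(ℕ, ℂ)) :=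
      continuous_const.add (lp.continuous_ofMatrix.comp continuous_fst)
    exact (h1.clm_apply (hVc.comp continuous_snd)).norm
  obtain ⟨⟨t, a⟩, ⟨ht, ha⟩, hmax⟩ := hcomp.exists_isMaxOn ⟨_, hne⟩ hFc.continuousOn
  refine ⟨t, V a, mem_closedBall_zero_iff.1 ht, ha, hVK a, fun s y hs hy => ?_⟩
  have hRQ : (S + lp.ofMatrix p s) (lp.coordProj hp K y) = (S + lp.ofMatrix p s) y := by
    rw [add_apply, add_apply, lp.ofMatrix_coordProj, ← ContinuousLinearMap.comp_apply, hSK]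
  rw [← hRQ, hVQ]
  refine hmax (a := (s, fun j : Fin K => y j)) ⟨mem_closedBall_zero_iff.2 hs, ?_⟩
  change ‖V fun j => y j‖ ≤ 1
  rw [← hVQ]
  exact (lp.norm_coordProj_apply_le hp K y).trans hy

/-- A norm-one operator `S` supported on the first `K` coordinates can be perturbed so that it
attains its norm at a vector whose image has all of its first `K` coordinates nonzero. Among the
matrices with entries close to those of `S`, one of maximal norm will do: if the image of a norming
vector had a vanishing coordinate, then changing one entry in that row would increase the norm. -/
theorem lp.exists_perturbation (hp : 0 < p.toReal) {S : ℓ^p(ℕ, ℂ) →L[ℂ] ℓ^p(ℕ, ℂ)} {K : ℕ}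
    (hSK : S ∘L lp.coordProj hp K = S) (hS : ‖S‖ ≤ 1) {z : ℓ^p(ℕ, ℂ)} (hz : ‖z‖ ≤ 1)
    (hSz : ‖S z‖ = 1) {ε : ℝ} (hε : 0 < ε) :
    ∃ (S' : ℓ^p(ℕ, ℂ) →L[ℂ] ℓ^p(ℕ, ℂ)) (x : ℓ^p(ℕ, ℂ)), S' ∘L lp.coordProj hp K = S' ∧
      ‖S'‖ ≤ 1 ∧ (∀ j, K ≤ j → x j = 0) ∧ ‖x‖ ≤ 1 ∧ ‖S' x‖ = 1 ∧ (∀ k < K, S' x k ≠ 0) ∧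
      ‖S' - S‖ < ε := by
  obtain ⟨δ, hδ, hEδ⟩ : ∃ δ > 0, ∀ t : Fin K → Fin K → ℂ, ‖t‖ ≤ δ →
      ‖(lp.ofMatrix p t : ℓ^p(ℕ, ℂ) →L[ℂ] ℓ^p(ℕ, ℂ))‖ < ε / 2 := by
    have h1 := (lp.continuous_ofMatrix (p := p) (K := K)).norm.tendsto 0
    rw [lp.ofMatrix_zero, _root_.norm_zero] at h1
    obtain ⟨δ, hδ, h2⟩ := Metric.nhds_basis_closedBall.eventually_iff.1
      (h1.eventually_lt_const (half_pos hε))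
    exact ⟨δ, hδ, fun t ht => h2 (mem_closedBall_zero_iff.2 ht)⟩
  obtain ⟨t, x, ht, hx, hxK, hmax⟩ := lp.exists_forall_norm_apply_le hp hSK hδ
  set R := S + lp.ofMatrix p t with hR
  set ρ := ‖R x‖ with hρ
  have hRQ : ∀ y, R (lp.coordProj hp K y) = R y := fun y => by
    rw [hR, add_apply, add_apply, lp.ofMatrix_coordProj,
      ← ContinuousLinearMap.comp_apply, hSK]
  have hρ1 : 1 ≤ ρ := by
    have h1 := hmax 0 z (by simpa using hδ.le) hz
    rwa [lp.ofMatrix_zero, add_zero, hSz] at h1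
  have hRρ : ‖R‖ ≤ ρ :=
    ContinuousLinearMap.opNorm_le_of_unit_norm (by linarith) fun y hy => hmax t y ht hy.le
  have hE := hEδ t ht
  have hρ2 : ρ ≤ 1 + ‖(lp.ofMatrix p t : ℓ^p(ℕ, ℂ) →L[ℂ] ℓ^p(ℕ, ℂ))‖ := by
    calc ρ ≤ ‖R‖ * ‖x‖ := R.le_opNorm _
      _ ≤ ‖R‖ := mul_le_of_le_one_right (norm_nonneg _) hx
      _ ≤ _ := (norm_add_le _ _).trans (by linarith)
  have hρ0 : (ρ : ℂ) ≠ 0 := by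
    rw [Complex.ofReal_ne_zero]
    linarith
  have hρn : ‖(ρ : ℂ)⁻¹‖ = ρ⁻¹ := by
    rw [norm_inv, Complex.norm_real, Real.norm_of_nonneg (by linarith)]
  have hcoord : ∀ k < K, R x k ≠ 0 := by
    intro k hk h0
    obtain ⟨j, hj⟩ : ∃ j : Fin K, x j ≠ 0 := by
      by_contra! h
      have : x = 0 := by
        ext j
        rcases lt_or_ge j K with hj | hj
        · exact h ⟨j, hj⟩
        · exact hxK j hj
      rw [hρ, this, map_zero, _root_.norm_zero] at hρ1
      linarith
    obtain ⟨t', ht', hlt⟩ :=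
      lp.exists_norm_lt_of_apply_eq_zero hp hδ ht (k := ⟨k, hk⟩) h0 hj
    exact hlt.not_ge (hmax t' x ht' hx)
  refine ⟨(ρ : ℂ)⁻¹ • R, x, ?_, ?_, hxK, hx, ?_, ?_, ?_⟩
  · ext1 y
    simp only [ContinuousLinearMap.comp_apply, smul_apply, hRQ]
  · rw [norm_smul, hρn]
    exact (mul_le_mul_of_nonneg_left hRρ (by positivity)).trans_eq
      (inv_mul_cancel₀ (by linarith))
  · rw [smul_apply, norm_smul, hρn, ← hρ]
    exact inv_mul_cancel₀ (by linarith)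
  · intro k hk
    rw [smul_apply, lp.coeFn_smul, Pi.smul_apply]
    exact smul_ne_zero (inv_ne_zero hρ0) (hcoord k hk)
  · have h1 : (ρ : ℂ)⁻¹ • R - S = ((ρ : ℂ)⁻¹ - 1) • R + lp.ofMatrix p t := by
      rw [sub_smul, one_smul, hR]
      abel
    have h2 : ‖(ρ : ℂ)⁻¹ - 1‖ = 1 - ρ⁻¹ := by
      rw [norm_sub_rev, ← Complex.ofReal_inv, ← Complex.ofReal_one, ← Complex.ofReal_sub,
        Complex.norm_real, Real.norm_of_nonneg]
      rw [sub_nonneg]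
      exact inv_le_one_of_one_le₀ hρ1
    calc ‖(ρ : ℂ)⁻¹ • R - S‖ ≤ ‖((ρ : ℂ)⁻¹ - 1) • R‖ + ‖lp.ofMatrix p t‖ := by
          rw [h1]
          exact norm_add_le _ _
      _ ≤ (1 - ρ⁻¹) * ρ + ‖lp.ofMatrix p t‖ := by
          rw [norm_smul, h2]
          gcongr
          rw [sub_nonneg]
          exact inv_le_one_of_one_le₀ hρ1
      _ = ρ - 1 + ‖lp.ofMatrix p t‖ := by
          rw [sub_mul, inv_mul_cancel₀ (by linarith), one_mul]
      _ < ε := by linarith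

end Perturbation

/-! ### Contractions moving one functional close to another -/

section Model

variable {p : ℝ≥0∞} [Fact (1 ≤ p)]

theorem lp.injOn_sub {N : ℕ} {A : Set ℕ} (hA : ∀ j ∈ A, N ≤ j) : A.InjOn fun j => j - N := by
  intro i hi j hj h
  have := hA i hi
  have := hA j hj
  simp only at h
  omega

/-- The shift by `N` places on `ℓ_p`, followed by the restriction to the coordinates in `[a, b)`,
where `N ≤ a`. -/
noncomputable def lp.shiftTo (hp : 0 < p.toReal) {N a : ℕ} (ha : N ≤ a) (b : ℕ) :
    ℓ^p(ℕ, ℂ) →L[ℂ] ℓ^p(ℕ, ℂ) :=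
  lp.compOn hp (Set.Ico a b) (fun j => j - N) (lp.injOn_sub fun _ hj => ha.trans hj.1)

theorem lp.shiftTo_apply (hp : 0 < p.toReal) {N a : ℕ} (ha : N ≤ a) (b : ℕ) (x : ℓ^p(ℕ, ℂ))
    (j : ℕ) : lp.shiftTo hp ha b x j = if a ≤ j ∧ j < b then x (j - N) else 0 := by
  simp [lp.shiftTo, lp.compOn_apply, Set.indicator_apply]

/-- The backward shift by `m` places on `ℓ_p`, followed by the projection onto the first `N`
coordinates. -/
noncomputable def lp.block (hp : 0 < p.toReal) (N m : ℕ) : ℓ^p(ℕ, ℂ) →L[ℂ] ℓ^p(ℕ, ℂ) :=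
  lp.compOn hp (Set.Iio N) (fun j => j + m) (add_left_injective m).injOn

theorem lp.block_apply (hp : 0 < p.toReal) (N m : ℕ) (x : ℓ^p(ℕ, ℂ)) (j : ℕ) :
    lp.block hp N m x j = if j < N then x (j + m) else 0 := by
  simp [lp.block, lp.compOn_apply, Set.indicator_apply]

/-- Split the coordinates into consecutive blocks of length `N`. On the zeroth block this operator
is `(1 - c) T`, compressed to that block, plus `c` times the shift to the first block; the first
`n - 1` of the other blocks are shifted isometrically to the next block, and the remaining ones are
killed. -/
noncomputable def lp.model (hp : 0 < p.toReal) (T : ℓ^p(ℕ, ℂ) →L[ℂ] ℓ^p(ℕ, ℂ)) (c : ℝ) (N n : ℕ) :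
    ℓ^p(ℕ, ℂ) →L[ℂ] ℓ^p(ℕ, ℂ) :=
  ((1 - c : ℝ) : ℂ) • (lp.coordProj hp N ∘L T ∘L lp.coordProj hp N) +
    (c : ℂ) • lp.shiftTo hp (le_refl N) (2 * N) +
    lp.shiftTo hp (show N ≤ 2 * N by omega) ((n + 1) * N)

theorem lp.model_apply_apply (hp : 0 < p.toReal) (T : ℓ^p(ℕ, ℂ) →L[ℂ] ℓ^p(ℕ, ℂ)) (c : ℝ) (N n : ℕ)
    (x : ℓ^p(ℕ, ℂ)) (j : ℕ) :
    lp.model hp T c N n x j =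
      ((1 - c : ℝ) : ℂ) * (if j < N then T (lp.coordProj hp N x) j else 0) +
        (c : ℂ) * (if N ≤ j ∧ j < 2 * N then x (j - N) else 0) +
        (if 2 * N ≤ j ∧ j < (n + 1) * N then x (j - N) else 0) := by
  rw [lp.model, add_apply, add_apply, smul_apply, smul_apply, lp.coeFn_add, lp.coeFn_add,
    lp.coeFn_smul, lp.coeFn_smul, Pi.add_apply, Pi.add_apply, Pi.smul_apply, Pi.smul_apply,
    lp.shiftTo_apply, lp.shiftTo_apply, ContinuousLinearMap.comp_apply,
    ContinuousLinearMap.comp_apply, lp.coordProj_apply, smul_eq_mul, smul_eq_mul]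

theorem lp.norm_model_apply_le (hp : 0 < p.toReal) {T : ℓ^p(ℕ, ℂ) →L[ℂ] ℓ^p(ℕ, ℂ)}
    (hT : ∀ x, ‖T x‖ ≤ ‖x‖) {c : ℝ} (hc0 : 0 < c) (hc1 : c < 1) (N n : ℕ) (x : ℓ^p(ℕ, ℂ)) :
    ‖lp.model hp T c N n x‖ ≤ ‖x‖ := by
  have hp1 : 1 ≤ p.toReal := by
    have hp' : p ≠ ⊤ := fun h => by simp [h] at hp
    rw [← ENNReal.toReal_one]
    exact ENNReal.toReal_mono hp' Fact.out
  set Q := lp.coordProj (p := p) hp N with hQ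
  -- the operator is the sum of three operators with disjointly supported ranges
  have hu : ‖((1 - c : ℝ) : ℂ) • Q (T (Q x))‖ ^ p.toReal ≤ (1 - c) * ‖Q x‖ ^ p.toReal := by
    rw [norm_smul, Complex.norm_real, Real.norm_of_nonneg (by linarith),
      Real.mul_rpow (by linarith) (norm_nonneg _)]
    gcongr
    · exact Real.rpow_le_self_of_le_one (by linarith) (by linarith) hp1
    · exact (lp.norm_coordProj_apply_le hp N _).trans (hT _)
  have hv : ‖(c : ℂ) • lp.shiftTo hp (le_refl N) (2 * N) x‖ ^ p.toReal ≤
      c * ‖Q x‖ ^ p.toReal := by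
    have h1 : lp.shiftTo hp (le_refl N) (2 * N) x = lp.shiftTo hp (le_refl N) (2 * N) (Q x) := by
      ext j
      rw [lp.shiftTo_apply, lp.shiftTo_apply, hQ, lp.coordProj_apply]
      split_ifs <;> first | rfl | omega
    rw [h1, norm_smul, Complex.norm_real, Real.norm_of_nonneg hc0.le,
      Real.mul_rpow hc0.le (norm_nonneg _)]
    gcongr
    · exact Real.rpow_le_self_of_le_one hc0.le hc1.le hp1
    · exact lp.norm_compOn_apply_le hp _ _
  have hw : ‖lp.shiftTo hp (show N ≤ 2 * N by omega) ((n + 1) * N) x‖ ^ p.toReal ≤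
      ‖x - Q x‖ ^ p.toReal := by
    have h1 : lp.shiftTo hp (show N ≤ 2 * N by omega) ((n + 1) * N) x =
        lp.shiftTo hp (show N ≤ 2 * N by omega) ((n + 1) * N) (x - Q x) := by
      ext j
      rw [lp.shiftTo_apply, lp.shiftTo_apply, hQ, lp.coeFn_sub, Pi.sub_apply, lp.coordProj_apply]
      split_ifs <;> first | omega | simp
    rw [h1]
    gcongr
    exact lp.norm_compOn_apply_le hp _ _
  rw [← Real.rpow_le_rpow_iff (norm_nonneg _) (norm_nonneg _) hp,
    ← lp.norm_coordProj_rpow_add hp N x, lp.model, add_apply, add_apply,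
    lp.norm_add_rpow_of_disjoint hp, lp.norm_add_rpow_of_disjoint hp]
  · rw [smul_apply, smul_apply, ContinuousLinearMap.comp_apply, ContinuousLinearMap.comp_apply]
    linarith
  · intro j
    rw [smul_apply, smul_apply, lp.coeFn_smul, lp.coeFn_smul, Pi.smul_apply, Pi.smul_apply,
      ContinuousLinearMap.comp_apply, lp.coordProj_apply, lp.shiftTo_apply]
    rcases lt_or_ge j N with hj | hj
    · right
      rw [if_neg (by omega), smul_zero]
    · left
      rw [if_neg (by omega), smul_zero]
  · intro j
    rw [lp.coeFn_add, Pi.add_apply, smul_apply, smul_apply, lp.coeFn_smul, lp.coeFn_smul,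
      Pi.smul_apply, Pi.smul_apply,
      ContinuousLinearMap.comp_apply, lp.coordProj_apply, lp.shiftTo_apply, lp.shiftTo_apply]
    rcases lt_or_ge j (2 * N) with hj | hj
    · right
      rw [if_neg (by omega)]
    · left
      rw [if_neg (by omega), if_neg (by omega), smul_zero, smul_zero, add_zero]

theorem lp.model_comp_coordProj (hp : 0 < p.toReal) (T : ℓ^p(ℕ, ℂ) →L[ℂ] ℓ^p(ℕ, ℂ)) (c : ℝ)
    (N n : ℕ) :
    lp.model hp T c N n ∘L lp.coordProj hp ((n + 1) * N) = lp.model hp T c N n := by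
  have hN : N ≤ (n + 1) * N := Nat.le_mul_of_pos_left N n.succ_pos
  ext x j
  have h1 : lp.coordProj hp N (lp.coordProj hp ((n + 1) * N) x) = lp.coordProj hp N x := by
    ext i
    simp only [lp.coordProj_apply]
    split_ifs <;> first | rfl | omega
  have h2 : (if N ≤ j ∧ j < 2 * N then lp.coordProj hp ((n + 1) * N) x (j - N) else 0) =
      if N ≤ j ∧ j < 2 * N then x (j - N) else 0 := by
    rw [lp.coordProj_apply]
    split_ifs <;> first | rfl | omega
  have h3 : (if 2 * N ≤ j ∧ j < (n + 1) * N then lp.coordProj hp ((n + 1) * N) x (j - N) else 0) =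
      if 2 * N ≤ j ∧ j < (n + 1) * N then x (j - N) else 0 := by
    rw [lp.coordProj_apply]
    split_ifs <;> first | rfl | omega
  rw [ContinuousLinearMap.comp_apply, lp.model_apply_apply, lp.model_apply_apply, h1, h2, h3]

theorem lp.norm_model_single (hp : 0 < p.toReal) {T : ℓ^p(ℕ, ℂ) →L[ℂ] ℓ^p(ℕ, ℂ)}
    (hT : ∀ x, ‖T x‖ ≤ ‖x‖) {c : ℝ} (hc0 : 0 < c) (hc1 : c < 1) {N n : ℕ} (hN : 0 < N)
    (hn : 2 ≤ n) : ‖lp.model hp T c N n (lp.single p N (1 : ℂ))‖ = 1 := by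
  have hpne : p ≠ 0 := (zero_lt_one.trans_le (Fact.out : 1 ≤ p)).ne'
  have h1 : ‖(lp.single p N (1 : ℂ) : ℓ^p(ℕ, ℂ))‖ = 1 := by
    rw [lp.norm_single hpne.bot_lt, norm_one]
  refine le_antisymm ((lp.norm_model_apply_le hp hT hc0 hc1 N n _).trans_eq h1) ?_
  refine le_trans (le_of_eq ?_) (lp.norm_apply_le_norm hpne _ (2 * N))
  have h2 : 3 * N ≤ (n + 1) * N := Nat.mul_le_mul_right N (by omega)
  rw [lp.model_apply_apply, if_neg (by omega), if_neg (by omega), if_pos (by omega),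
    lp.single_apply, show 2 * N - N = N by omega]
  simp

/-- On the zeroth block, the powers of the model operator are those of its compression. -/
theorem lp.coordProj_comp_model_pow (hp : 0 < p.toReal) (T : ℓ^p(ℕ, ℂ) →L[ℂ] ℓ^p(ℕ, ℂ)) (c : ℝ)
    (N n m : ℕ) :
    lp.coordProj hp N ∘L (lp.model hp T c N n ^ m) =
      ((((1 - c : ℝ) : ℂ) • (lp.coordProj hp N ∘L T ∘L lp.coordProj hp N)) ^ m) ∘L
        lp.coordProj hp N := by
  set A := ((1 - c : ℝ) : ℂ) • (lp.coordProj hp N ∘L T ∘L lp.coordProj hp N) with hA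
  have h1 : lp.coordProj hp N ∘L lp.model hp T c N n = A ∘L lp.coordProj hp N := by
    ext x j
    rw [ContinuousLinearMap.comp_apply, ContinuousLinearMap.comp_apply, lp.coordProj_apply,
      lp.model_apply_apply, hA, smul_apply, lp.coeFn_smul, Pi.smul_apply,
      ContinuousLinearMap.comp_apply, ContinuousLinearMap.comp_apply, lp.coordProj_apply,
      lp.coordProj_coordProj, smul_eq_mul]
    rcases lt_or_ge j N with hj | hj
    · rw [if_pos hj, if_pos hj, if_neg (by omega), if_neg (by omega)]
      ring
    · rw [if_neg (by omega), if_neg (by omega), mul_zero]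
  induction m with
  | zero => ext; rfl
  | succ m ih =>
    calc lp.coordProj hp N ∘L (lp.model hp T c N n ^ (m + 1))
        = (lp.coordProj hp N ∘L (lp.model hp T c N n ^ m)) ∘L lp.model hp T c N n := by
          rw [pow_succ]; rfl
      _ = (A ^ m) ∘L (lp.coordProj hp N ∘L lp.model hp T c N n) := by rw [ih]; rfl
      _ = (A ^ (m + 1)) ∘L lp.coordProj hp N := by rw [h1, pow_succ]; rfl

/-- Functionals on the `i`-th block are carried to the zeroth block in `i` steps. -/
theorem lp.block_comp_model_pow (hp : 0 < p.toReal) (T : ℓ^p(ℕ, ℂ) →L[ℂ] ℓ^p(ℕ, ℂ)) (c : ℝ)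
    (N : ℕ) {n i : ℕ} (hi : 1 ≤ i) (hin : i ≤ n) :
    lp.block hp N (i * N) ∘L (lp.model hp T c N n ^ i) = (c : ℂ) • lp.coordProj hp N := by
  induction i, hi using Nat.le_induction with
  | base =>
    ext x j
    rw [pow_one, one_mul, ContinuousLinearMap.comp_apply, lp.block_apply, lp.model_apply_apply,
      smul_apply, lp.coeFn_smul, Pi.smul_apply, lp.coordProj_apply, smul_eq_mul]
    rcases lt_or_ge j N with hj | hj
    · rw [if_pos hj, if_pos hj, if_neg (by omega), if_pos (by omega), if_neg (by omega),
        Nat.add_sub_cancel]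
      ring
    · rw [if_neg (by omega), if_neg (by omega), mul_zero]
  | succ i hi ih =>
    have h1 : lp.block hp N ((i + 1) * N) ∘L lp.model hp T c N n = lp.block hp N (i * N) := by
      ext x j
      rw [ContinuousLinearMap.comp_apply, lp.block_apply, lp.model_apply_apply, lp.block_apply]
      rcases lt_or_ge j N with hj | hj
      · have h2 : N ≤ i * N := Nat.le_mul_of_pos_left N (by omega)
        have h3 : (i + 2) * N ≤ (n + 1) * N := Nat.mul_le_mul_right N (by omega)
        have h4 : (i + 1) * N = i * N + N := by ring
        have h5 : (i + 2) * N = i * N + 2 * N := by ring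
        rw [if_pos hj, if_pos hj, if_neg (by omega), if_neg (by omega), if_pos (by omega),
          show j + (i + 1) * N - N = j + i * N by omega]
        ring
      · rw [if_neg (by omega), if_neg (by omega)]
    rw [← ih (by omega), ← h1, pow_succ']
    rfl

theorem lp.norm_model_apply_sub_le (hp : 0 < p.toReal) (T : ℓ^p(ℕ, ℂ) →L[ℂ] ℓ^p(ℕ, ℂ)) {c : ℝ}
    (hc0 : 0 < c) (N n : ℕ) (x : ℓ^p(ℕ, ℂ)) :
    ‖lp.model hp T c N n x - T x‖ ≤
      ‖((1 - c : ℝ) : ℂ) • lp.coordProj hp N (T (lp.coordProj hp N x)) - T x‖ + c * ‖x‖ +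
        ‖x - lp.coordProj hp N x‖ := by
  have h1 : lp.shiftTo hp (show N ≤ 2 * N by omega) ((n + 1) * N) x =
      lp.shiftTo hp (show N ≤ 2 * N by omega) ((n + 1) * N) (x - lp.coordProj hp N x) := by
    ext j
    rw [lp.shiftTo_apply, lp.shiftTo_apply, lp.coeFn_sub, Pi.sub_apply, lp.coordProj_apply]
    split_ifs <;> first | omega | simp
  have h2 : lp.model hp T c N n x - T x =
      (((1 - c : ℝ) : ℂ) • lp.coordProj hp N (T (lp.coordProj hp N x)) - T x) +
        (c : ℂ) • lp.shiftTo hp (le_refl N) (2 * N) x +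
        lp.shiftTo hp (show N ≤ 2 * N by omega) ((n + 1) * N) x := by
    rw [lp.model, add_apply, add_apply, smul_apply, smul_apply, ContinuousLinearMap.comp_apply,
      ContinuousLinearMap.comp_apply]
    abel
  rw [h2]
  refine (norm_add₃_le).trans ?_
  gcongr
  · rw [norm_smul, Complex.norm_real, Real.norm_of_nonneg hc0.le]
    gcongr
    exact lp.norm_compOn_apply_le hp _ _
  · rw [h1]
    exact lp.norm_compOn_apply_le hp _ _

/-- For `M > 1` the model operators have a functional `h` near `f` which is sent exactly to `g` by
the `n`-th power of `M` times the adjoint: to `f` one adds a functional on the `n`-th block, which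
can be small because it has to produce only `M⁻ⁿ g - f ((1 - c) Q T Q)ⁿ` up to a factor
independent of `n`. -/
theorem lp.exists_model_transfer (hp : 0 < p.toReal) {T : ℓ^p(ℕ, ℂ) →L[ℂ] ℓ^p(ℕ, ℂ)}
    (hT : ∀ x, ‖T x‖ ≤ ‖x‖) {c : ℝ} (hc0 : 0 < c) (hc1 : c < 1) {N : ℕ} {M : ℝ} (hM : 1 < M)
    {f g : StrongDual ℂ ℓ^p(ℕ, ℂ)} (hf : f ∘L lp.coordProj hp N = f)
    (hg : g ∘L lp.coordProj hp N = g) {ε : ℝ} (hε : 0 < ε) :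
    ∃ (n : ℕ) (h : StrongDual ℂ ℓ^p(ℕ, ℂ)), 2 ≤ n ∧ h ∘L lp.coordProj hp ((n + 1) * N) = h ∧
      ‖h - f‖ < ε ∧ (M : ℂ) ^ n • (h ∘L (lp.model hp T c N n ^ n)) = g := by
  set A := ((1 - c : ℝ) : ℂ) • (lp.coordProj hp N ∘L T ∘L lp.coordProj hp N) with hA
  have hAn : ‖A‖ ≤ 1 - c := by
    refine ContinuousLinearMap.opNorm_le_bound _ (by linarith) fun x => ?_
    rw [hA, smul_apply, norm_smul, Complex.norm_real, Real.norm_of_nonneg (by linarith)]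
    gcongr
    exact (lp.norm_coordProj_apply_le hp N _).trans
      ((hT _).trans (lp.norm_coordProj_apply_le hp N _))
  have hlim : Tendsto (fun n : ℕ => c⁻¹ * (M⁻¹ ^ n * ‖g‖ + ‖f‖ * (1 - c) ^ n)) atTop (𝓝 0) := by
    have h1 := (tendsto_pow_atTop_nhds_zero_of_lt_one (inv_nonneg.2 (zero_le_one.trans hM.le))
      (inv_lt_one_of_one_lt₀ hM)).mul_const ‖g‖
    have h2 := (tendsto_pow_atTop_nhds_zero_of_lt_one (show 0 ≤ 1 - c by linarith)
      (show 1 - c < 1 by linarith)).const_mul ‖f‖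
    simpa using (h1.add h2).const_mul c⁻¹
  obtain ⟨n, hnε, hn⟩ := ((hlim.eventually_lt_const hε).and (eventually_ge_atTop 2)).exists
  have hM0 : (M : ℂ) ≠ 0 := Complex.ofReal_ne_zero.2 (by linarith)
  have hcC : (c : ℂ) ≠ 0 := Complex.ofReal_ne_zero.2 hc0.ne'
  let w : StrongDual ℂ ℓ^p(ℕ, ℂ) := (c : ℂ)⁻¹ • (((M : ℂ)⁻¹ ^ n) • g - f ∘L (A ^ n))
  have hNK : N ≤ (n + 1) * N := Nat.le_mul_of_pos_left N n.succ_pos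
  refine ⟨n, f + w ∘L lp.block hp N (n * N), hn, ?_, ?_, ?_⟩
  · have h1 : lp.coordProj hp N ∘L lp.coordProj hp ((n + 1) * N) =
        (lp.coordProj hp N : ℓ^p(ℕ, ℂ) →L[ℂ] ℓ^p(ℕ, ℂ)) := by
      ext x i
      simp only [ContinuousLinearMap.comp_apply, lp.coordProj_apply]
      split_ifs <;> first | rfl | omega
    have h2 : lp.block hp N (n * N) ∘L lp.coordProj hp ((n + 1) * N) =
        (lp.block hp N (n * N) : ℓ^p(ℕ, ℂ) →L[ℂ] ℓ^p(ℕ, ℂ)) := by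
      have h4 : (n + 1) * N = n * N + N := by ring
      ext x i
      simp only [ContinuousLinearMap.comp_apply, lp.block_apply, lp.coordProj_apply]
      split_ifs <;> first | rfl | omega
    have h3 : f ∘L lp.coordProj hp ((n + 1) * N) = f := by
      conv_lhs => rw [← hf]
      rw [ContinuousLinearMap.comp_assoc, h1, hf]
    rw [ContinuousLinearMap.add_comp, h3, ContinuousLinearMap.comp_assoc, h2]
  · rw [add_sub_cancel_left]
    refine lt_of_le_of_lt ?_ hnε
    have hb : ‖(lp.block hp N (n * N) : ℓ^p(ℕ, ℂ) →L[ℂ] ℓ^p(ℕ, ℂ))‖ ≤ 1 :=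
      ContinuousLinearMap.opNorm_le_bound _ zero_le_one fun x => by
        rw [one_mul]
        exact lp.norm_compOn_apply_le hp _ x
    calc ‖w ∘L lp.block hp N (n * N)‖ ≤ ‖w‖ * ‖lp.block hp N (n * N)‖ :=
          ContinuousLinearMap.opNorm_comp_le _ _
      _ ≤ ‖w‖ := mul_le_of_le_one_right (norm_nonneg _) hb
      _ ≤ c⁻¹ * (M⁻¹ ^ n * ‖g‖ + ‖f‖ * (1 - c) ^ n) := by
          rw [norm_smul, norm_inv, Complex.norm_real, Real.norm_of_nonneg hc0.le]
          gcongr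
          refine (norm_sub_le _ _).trans ?_
          gcongr
          · rw [norm_smul, norm_pow, norm_inv, Complex.norm_real,
              Real.norm_of_nonneg (by linarith)]
          · refine (ContinuousLinearMap.opNorm_comp_le _ _).trans ?_
            gcongr
            exact (norm_pow_le' A (by omega)).trans (by gcongr)
  · have h1 : f ∘L (lp.model hp T c N n ^ n) = (f ∘L (A ^ n)) ∘L lp.coordProj hp N := by
      conv_lhs => rw [← hf]
      rw [ContinuousLinearMap.comp_assoc, lp.coordProj_comp_model_pow]
      rfl
    rw [ContinuousLinearMap.add_comp, ContinuousLinearMap.comp_assoc,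
      lp.block_comp_model_pow hp T c N (by omega) le_rfl, h1]
    have h2 : w ∘L ((c : ℂ) • lp.coordProj hp N) =
        ((M : ℂ)⁻¹ ^ n) • g - (f ∘L (A ^ n)) ∘L lp.coordProj hp N := by
      rw [ContinuousLinearMap.comp_smul]
      change (c : ℂ) • (((c : ℂ)⁻¹ • (((M : ℂ)⁻¹ ^ n) • g - f ∘L (A ^ n))) ∘L
        lp.coordProj hp N) = _
      rw [ContinuousLinearMap.smul_comp, smul_smul, mul_inv_cancel₀ hcC, one_smul,
        ContinuousLinearMap.sub_comp, ContinuousLinearMap.smul_comp, hg]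
    rw [h2, add_sub_cancel, smul_smul, ← mul_pow, mul_inv_cancel₀ hM0, one_pow, one_smul]

end Model

/-! ### Typical contractions -/

section Typical

variable {p : ℝ≥0∞} [Fact (1 ≤ p)]

/-- Perturbing a model operator gives interior points, for the strong operator topology, of the set
of contractions `S` for which some power of `(MS)*` moves a point near `f` to a point near `g`. -/
theorem lp.exists_mem_interior_transfer (hp : 2 < p.toReal) (hp0 : 0 < p.toReal)
    (T : SOTContraction ℓ^p(ℕ, ℂ)) {c : ℝ} (hc0 : 0 < c) (hc1 : c < 1) {N : ℕ} (hN : 0 < N)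
    {M : ℝ} (hM : 1 < M) {f g : StrongDual ℂ ℓ^p(ℕ, ℂ)} (hf : f ∘L lp.coordProj hp0 N = f)
    (hg : g ∘L lp.coordProj hp0 N = g) {ε : ℝ} (hε : 0 < ε) :
    ∃ S : SOTContraction ℓ^p(ℕ, ℂ),
      S ∈ interior {R : SOTContraction ℓ^p(ℕ, ℂ) | ∃ (n : ℕ) (h : StrongDual ℂ ℓ^p(ℕ, ℂ)),
        ‖h - f‖ < ε ∧ ‖(M : ℂ) ^ n • (h ∘L R.toCLM ^ n) - g‖ < ε} ∧
      ∀ x, ‖S.toCLM x - T.toCLM x‖ ≤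
        ‖((1 - c : ℝ) : ℂ) • lp.coordProj hp0 N (T.toCLM (lp.coordProj hp0 N x)) - T.toCLM x‖ +
          c * ‖x‖ + ‖x - lp.coordProj hp0 N x‖ + c * ‖x‖ := by
  have hpne : p ≠ 0 := (zero_lt_one.trans_le (Fact.out : 1 ≤ p)).ne'
  obtain ⟨n, h, hn, hhK, hhf, hhg⟩ :=
    lp.exists_model_transfer hp0 T.norm_apply_le hc0 hc1 hM hf hg hε
  set S₀ := lp.model hp0 T.toCLM c N n with hS₀
  -- being moved close to `g` is an open condition for the operator norm
  have hcont : Continuous fun R : ℓ^p(ℕ, ℂ) →L[ℂ] ℓ^p(ℕ, ℂ) =>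
      ‖(M : ℂ) ^ n • (h ∘L (R ^ n)) - g‖ :=
    (((continuous_const.clm_comp (continuous_pow n)).const_smul ((M : ℂ) ^ n)).sub
      continuous_const).norm
  obtain ⟨η, hη, hηball⟩ := Metric.eventually_nhds_iff.1
    ((hcont.tendsto S₀).eventually_lt_const (show ‖(M : ℂ) ^ n • (h ∘L (S₀ ^ n)) - g‖ < ε by
      rw [hhg, sub_self, _root_.norm_zero]; exact hε))
  have hS₀n : ‖S₀‖ ≤ 1 := ContinuousLinearMap.opNorm_le_bound _ zero_le_one fun x => by
    rw [one_mul]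
    exact lp.norm_model_apply_le hp0 T.norm_apply_le hc0 hc1 N n x
  obtain ⟨S', x, hS'K, hS'1, hxK, hx1, hS'x, hS'k, hS'S⟩ := lp.exists_perturbation hp0
    (lp.model_comp_coordProj hp0 T.toCLM c N n) hS₀n
    (z := lp.single p N (1 : ℂ)) (by rw [lp.norm_single hpne.bot_lt, norm_one])
    (lp.norm_model_single hp0 T.norm_apply_le hc0 hc1 hN hn) (lt_min hη hc0)
  let S : SOTContraction ℓ^p(ℕ, ℂ) := ⟨S', hS'1⟩
  refine ⟨S, ?_, fun y => ?_⟩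
  · rw [mem_interior_iff_mem_nhds]
    have h1 := lp.tendsto_comp_pow hp hp0 (S := S) hS'K hxK hx1 hS'x hS'k hhK n
    have h2 := ((h1.const_smul ((M : ℂ) ^ n)).sub_const g).norm
    have h3 : ‖(M : ℂ) ^ n • (h ∘L (S' ^ n)) - g‖ < ε :=
      hηball (by rw [dist_eq_norm]; exact hS'S.trans_le (min_le_left _ _))
    filter_upwards [h2.eventually_lt_const h3] with R hR
    exact ⟨n, h, hhf, hR⟩
  · have h1 : S.toCLM y - T.toCLM y = (S₀ y - T.toCLM y) + (S' - S₀) y := by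
      rw [sub_apply]
      change S' y - T.toCLM y = _
      abel
    rw [h1]
    refine (norm_add_le _ _).trans (add_le_add (lp.norm_model_apply_sub_le hp0 _ hc0 N n y) ?_)
    refine ((S' - S₀).le_opNorm y).trans ?_
    gcongr
    exact hS'S.le.trans (min_le_right _ _)

theorem lp.dense_interior_transfer (hp : 2 < p.toReal) {M : ℝ} (hM : 1 < M)
    (f g : StrongDual ℂ ℓ^p(ℕ, ℂ)) {ε : ℝ} (hε : 0 < ε) :
    Dense (interior {R : SOTContraction ℓ^p(ℕ, ℂ) | ∃ (n : ℕ) (h : StrongDual ℂ ℓ^p(ℕ, ℂ)),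
      ‖h - f‖ < ε ∧ ‖(M : ℂ) ^ n • (h ∘L R.toCLM ^ n) - g‖ < ε}) := by
  have hp0 : 0 < p.toReal := by linarith
  intro T
  let c : ℕ → ℝ := fun N => 1 / ((N : ℝ) + 1 + 1)
  have hc0 : ∀ N, 0 < c N := fun N => by positivity
  have hc1 : ∀ N, c N < 1 := fun N => by
    rw [div_lt_one (by positivity)]
    linarith [(N.cast_nonneg : (0 : ℝ) ≤ N)]
  have hclim : Tendsto c atTop (𝓝 0) := by
    have := (tendsto_add_atTop_iff_nat 1).2 (tendsto_one_div_add_atTop_nhds_zero_nat (𝕜 := ℝ))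
    simpa [c] using this
  have hproj : ∀ N, (lp.coordProj hp0 N : ℓ^p(ℕ, ℂ) →L[ℂ] ℓ^p(ℕ, ℂ)) ∘L lp.coordProj hp0 N =
      lp.coordProj hp0 N := fun N => by
    ext1 x
    exact lp.coordProj_coordProj hp0 N x
  choose S hSint hSdist using fun N : ℕ => lp.exists_mem_interior_transfer hp hp0 T (hc0 N) (hc1 N)
    N.succ_pos hM (f := f ∘L lp.coordProj hp0 (N + 1)) (g := g ∘L lp.coordProj hp0 (N + 1))
    (by rw [ContinuousLinearMap.comp_assoc, hproj]) (by rw [ContinuousLinearMap.comp_assoc, hproj])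
    (half_pos hε)
  refine mem_closure_of_tendsto (f := S) (b := atTop) ?_ ?_
  · rw [SOTContraction.tendsto_iff]
    intro x
    rw [tendsto_iff_norm_sub_tendsto_zero]
    refine squeeze_zero (fun _ => norm_nonneg _) (fun N => hSdist N x) ?_
    have hQ : ∀ y : ℓ^p(ℕ, ℂ), Tendsto (fun N => lp.coordProj hp0 (N + 1) y) atTop (𝓝 y) :=
      fun y => (tendsto_add_atTop_iff_nat 1).2 (lp.tendsto_coordProj hp0 y)
    have h1 : Tendsto (fun N => lp.coordProj hp0 (N + 1)
        (T.toCLM (lp.coordProj hp0 (N + 1) x))) atTop (𝓝 (T.toCLM x)) := by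
      have h2 : Tendsto (fun N => lp.coordProj hp0 (N + 1)
          (T.toCLM (lp.coordProj hp0 (N + 1) x)) - lp.coordProj hp0 (N + 1) (T.toCLM x))
          atTop (𝓝 0) := by
        refine squeeze_zero_norm (fun N => ?_) (tendsto_iff_norm_sub_tendsto_zero.1 (hQ x))
        rw [← map_sub, ← map_sub]
        exact (lp.norm_coordProj_apply_le hp0 _ _).trans (T.norm_apply_le _)
      simpa using h2.add (hQ (T.toCLM x))
    have h3 : Tendsto (fun N => ((1 - c N : ℝ) : ℂ)) atTop (𝓝 1) := by
      have := (Complex.continuous_ofReal.tendsto (1 - 0)).comp (hclim.const_sub 1)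
      rwa [sub_zero, Complex.ofReal_one] at this
    have h4 := tendsto_iff_norm_sub_tendsto_zero.1 (h3.smul h1)
    have h5 := tendsto_iff_norm_sub_tendsto_zero.1 (hQ x)
    have h6 := hclim.mul_const ‖x‖
    rw [one_smul] at h4
    have h7 := ((h4.add h6).add h5).add h6
    simp only [zero_mul, add_zero] at h7
    refine h7.congr fun N => ?_
    rw [norm_sub_rev x]
  · have hQ : ∀ φ : StrongDual ℂ ℓ^p(ℕ, ℂ), ∀ᶠ N : ℕ in atTop,
        ‖φ ∘L lp.coordProj hp0 (N + 1) - φ‖ < ε / 2 := fun φ =>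
      ((tendsto_iff_norm_sub_tendsto_zero.1 ((tendsto_add_atTop_iff_nat 1).2
        (lp.tendsto_comp_coordProj hp hp0 φ))).eventually_lt_const (half_pos hε))
    filter_upwards [hQ f, hQ g] with N hNf hNg
    refine interior_mono ?_ (hSint N)
    rintro R ⟨n, h, h1, h2⟩
    refine ⟨n, h, ?_, ?_⟩
    · have := norm_sub_le_norm_sub_add_norm_sub h (f ∘L lp.coordProj hp0 (N + 1)) f
      linarith
    · have := norm_sub_le_norm_sub_add_norm_sub ((M : ℂ) ^ n • (h ∘L R.toCLM ^ n))
        (g ∘L lp.coordProj hp0 (N + 1)) g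
      linarith

end Typical

theorem theorem4p3 (p : ℝ≥0∞) [Fact (1 ≤ p)] (hp : 2 < p) (hp_top : p ≠ ∞) :
    (∀ M : ℝ, 1 < M →
      IsTypical fun T : SOTContraction (lp (fun _ : ℕ => ℂ) p) =>
        IsHypercyclic (banachAdjoint ((M : ℂ) • T.toCLM))) ∧
    IsTypical fun T : SOTContraction (lp (fun _ : ℕ => ℂ) p) =>
      ∀ μ : ℂ, ¬ Module.End.HasEigenvalue (T.toCLM : Module.End ℂ (lp (fun _ : ℕ => ℂ) p)) μ := by
  have hp2 : 2 < p.toReal := by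
    have := (ENNReal.toReal_lt_toReal ENNReal.ofNat_ne_top hp_top).2 hp
    simpa using this
  have h1 := lp.separableSpace (p := p) (by linarith)
  have h2 := lp.separableSpace_dual hp2
  have key : ∀ M : ℝ, 1 < M → IsTypical fun T : SOTContraction (lp (fun _ : ℕ => ℂ) p) =>
      IsHypercyclic (banachAdjoint ((M : ℂ) • T.toCLM)) := fun M hM =>
    isTypical_isHypercyclic_adjoint (M : ℂ) fun f g ε hε => lp.dense_interior_transfer hp2 hM f g hε
  refine ⟨key, ?_⟩
  obtain ⟨G, hG, hGd, hGT⟩ := key 2 one_lt_two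
  exact ⟨G, hG, hGd, fun T hT μ => not_hasEigenvalue_of_isHypercyclic_adjoint (hGT T hT) μ⟩
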